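/- Let $\tau\in\mathbb C$ with $\operatorname{Im}\tau>0$, let $$\theta_1(t,\tau)=-\sum_{j\in\mathbb Z}e^{\pi i(j+\frac12)^2\tau+2\pi i(j+\frac12)(t+\frac12)},\qquad \sigma(w,t)=\frac{\theta_1(w-t,\tau)\,\partial_t\theta_1(0,\tau)}{\theta_1(w,\tau)\,\theta_1(t,\tau)},$$ and let $\gamma\in\mathbb C$ with $\theta_1(\gamma,\tau)\neq0$ (equivalently $\gamma\notin\mathbb Z+\tau\mathbb Z$). Let $\mathfrak h$ be the abelian Lie algebra of diagonal complex $N\times N$ matrices $\lambda=\operatorname{diag}(\lambda_1,\dots,\lambda_N)$, with the bilinear form $(A,B)=\operatorname{Trace}(AB)$, acting on $V=\mathbb C^N$; write $\lambda_{ij}=\lambda_i-\lambda_j$, let $E_{ij}$ be the elementary matrices, let $V[\mu]=\{v: Xv=(\mu,X)v\ \forall X\in\mathfrak h\}$ for $\mu\in\mathfrak h$ be the weight spaces, and let $P_\mu$ be the projection of $V$ onto $V[\mu]$ along the other weight spaces. Then $V$ is the direct sum of its weight spaces. Define $$R(z,\lambda)=\sum_{i}E_{ii}\otimes E_{ii}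 +\sum_{i\neq j}\frac{\sigma(\gamma,\lambda_{ij})}{\sigma(\gamma,z)}E_{ii}\otimes E_{jj} +\sum_{i\neq j}\frac{\sigma(\lambda_{ij},z)}{\sigma(\gamma,z)}E_{ij}\otimes E_{ji}.$$ Then $R$ is a generalized quantum $R$-matrix with $\eta=\gamma/2$. That is, $R$ is a meromorphic function of $(z,\lambda)\in\mathbb C\times\mathfrak h$ with values in $\operatorname{End}(V\otimes V)$, and the following identities of meromorphic functions hold. (Superscripts indicate the tensor factors on which an operator acts, $z_{ij}=z_i-z_j$, and $f(\lambda+c\,h^{(k)})=\sum_\mu P^{(k)}_\mu f(\lambda+c\mu)$.) 1. (Modified Yang–Baxter equation) In $\operatorname{End}(V\otimes V\otimes V)$, as functions of $(z_1,z_2,z_3,\lambda)$, $$R^{(12)}(z_{12},\lambda+\eta h^{(3)})\,R^{(13)}(z_{13},\lambda-\eta h^{(2)})\,R^{(23)}(z_{23},\lambda+\eta h^{(1)}) =R^{(23)}(z_{23},\lambda-\eta h^{(1)})\,R^{(13)}(z_{13},\lambda+\eta h^{(2)})\,R^{(12)}(z_{12},\lambda-\eta h^{(3)}).$$ 2. (Unitarity)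 $R^{(12)}(z,\lambda)\,R^{(21)}(-z,\lambda)=\mathrm{Id}_{V\otimes V}$. 3. (Weight zero) $[X^{(1)}+X^{(2)},R(z,\lambda)]=0$ for all $X\in\mathfrak h$. -/

import Mathlib

open scoped TensorProduct

noncomputable section

namespace EllipticRMatrix

/-! ### Meromorphic functions of several complex variables -/

/-- A scalar function on a complex normed space is meromorphic if near every point it is a
quotient `g / h` of holomorphic functions with `h` not identically zero near that point. The
values of `f` at the zeros of the local denominators are irrelevant. -/
def IsMeromorphic {E : Type*} [NormedAddCommGroup E] [NormedSpace ℂ E] (f : E → ℂ) : Prop :=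
  ∀ x : E, ∃ g h : E → ℂ, AnalyticAt ℂ g x ∧ AnalyticAt ℂ h x ∧
    (∃ᶠ y in nhds x, h y ≠ 0) ∧ ∀ᶠ y in nhds x, h y ≠ 0 → f y = g y / h y

/-- A function with values in a finite-dimensional space is meromorphic if all of its
coordinates are, that is, if its composition with every linear functional is. -/
def IsMeromorphicVec {E : Type*} [NormedAddCommGroup E] [NormedSpace ℂ E]
    {W : Type*} [AddCommGroup W] [Module ℂ W] (f : E → W) : Prop :=
  ∀ φ : W →ₗ[ℂ] ℂ, IsMeromorphic fun x => φ (f x)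

/-- Equality of meromorphic functions: equality on a dense open set (poles are removed). -/
def MeroEq {E : Type*} [TopologicalSpace E] {W : Type*} (f g : E → W) : Prop :=
  ∃ U : Set E, IsOpen U ∧ Dense U ∧ Set.EqOn f g U

/-! ### Diagonalizable modules over an abelian Lie algebra with a bilinear form -/

section Modules

variable {𝔥 V : Type*} [AddCommGroup 𝔥] [Module ℂ 𝔥] [AddCommGroup V] [Module ℂ V]

/-- The weight space `V[μ]`, on which every `X : 𝔥` acts as the scalar `(μ, X)`. -/
def weightSpace (B : LinearMap.BilinForm ℂ 𝔥) (ρ : 𝔥 →ₗ[ℂ] Module.End ℂ V) (μ : 𝔥) :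
    Submodule ℂ V where
  carrier := {v | ∀ X : 𝔥, ρ X v = B μ X • v}
  add_mem' := by
    intro a b ha hb X
    rw [map_add, ha X, hb X, smul_add]
  zero_mem' := by
    intro X
    simp
  smul_mem' := by
    intro c v hv X
    rw [map_smul, hv X, smul_comm]

/-- `V` is diagonalizable: it is the direct sum of its weight spaces. -/
def IsDiagonalizable (B : LinearMap.BilinForm ℂ 𝔥) (ρ : 𝔥 →ₗ[ℂ] Module.End ℂ V) : Prop :=
  iSupIndep (weightSpace B ρ) ∧ ⨆ μ, weightSpace B ρ μ = ⊤

open Classical in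
/-- The projection `P_μ` of a diagonalizable module `V` onto `V[μ]` along the other weight
spaces. -/
def weightProj (B : LinearMap.BilinForm ℂ 𝔥) (ρ : 𝔥 →ₗ[ℂ] Module.End ℂ V) (μ : 𝔥) :
    Module.End ℂ V :=
  if h : IsCompl (weightSpace B ρ μ) (⨆ ν, ⨆ _ : ν ≠ μ, weightSpace B ρ ν)
  then Submodule.projection (weightSpace B ρ μ) (⨆ ν, ⨆ _ : ν ≠ μ, weightSpace B ρ ν) h
  else 0

end Modules

/-! ### Operators acting on chosen factors of a tensor product

The triple tensor product is `V ⊗ (V ⊗ V)`. -/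

section Legs

variable {V : Type*} [AddCommGroup V] [Module ℂ V]

/-- `A⁽¹⁾ = A ⊗ 1 ⊗ 1`. -/
def leg1 (A : Module.End ℂ V) : Module.End ℂ (V ⊗[ℂ] (V ⊗[ℂ] V)) :=
  TensorProduct.map A LinearMap.id

/-- `A⁽²⁾ = 1 ⊗ A ⊗ 1`. -/
def leg2 (A : Module.End ℂ V) : Module.End ℂ (V ⊗[ℂ] (V ⊗[ℂ] V)) :=
  TensorProduct.map LinearMap.id (TensorProduct.map A LinearMap.id)

/-- `A⁽³⁾ = 1 ⊗ 1 ⊗ A`. -/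
def leg3 (A : Module.End ℂ V) : Module.End ℂ (V ⊗[ℂ] (V ⊗[ℂ] V)) :=
  TensorProduct.map LinearMap.id (TensorProduct.map LinearMap.id A)

/-- `T⁽²³⁾`: the operator `T` acting on the second and third factors. -/
def leg23 (T : Module.End ℂ (V ⊗[ℂ] V)) : Module.End ℂ (V ⊗[ℂ] (V ⊗[ℂ] V)) :=
  TensorProduct.map LinearMap.id T

/-- `T⁽¹²⁾`: the operator `T` acting on the first and second factors. -/
def leg12 (T : Module.End ℂ (V ⊗[ℂ] V)) : Module.End ℂ (V ⊗[ℂ] (V ⊗[ℂ] V)) :=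
  (TensorProduct.assoc ℂ V V V).toLinearMap ∘ₗ TensorProduct.map T LinearMap.id ∘ₗ
    (TensorProduct.assoc ℂ V V V).symm.toLinearMap

/-- The exchange of the second and third factors. -/
def swap23 : Module.End ℂ (V ⊗[ℂ] (V ⊗[ℂ] V)) :=
  TensorProduct.map LinearMap.id (TensorProduct.comm ℂ V V).toLinearMap

/-- `T⁽¹³⁾`: the operator `T` acting on the first and third factors. -/
def leg13 (T : Module.End ℂ (V ⊗[ℂ] V)) : Module.End ℂ (V ⊗[ℂ] (V ⊗[ℂ] V)) :=
  swap23 ∘ₗ leg12 T ∘ₗ swap23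

/-- `T⁽²¹⁾` on `V ⊗ V`: conjugation of `T` by the exchange of the two factors. -/
def leg21 (T : Module.End ℂ (V ⊗[ℂ] V)) : Module.End ℂ (V ⊗[ℂ] V) :=
  (TensorProduct.comm ℂ V V).toLinearMap ∘ₗ T ∘ₗ (TensorProduct.comm ℂ V V).toLinearMap

end Legs

/-! ### Generalized quantum R-matrices -/

section RMatrix

variable {𝔥 V : Type*} [NormedAddCommGroup 𝔥] [NormedSpace ℂ 𝔥] [AddCommGroup V] [Module ℂ V]

/-- The function `f(λ + c h⁽ᵏ⁾) = ∑_μ P_μ⁽ᵏ⁾ f(λ + c μ)`, where `leg` is `A ↦ A⁽ᵏ⁾`.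
(The sum has finitely many nonzero terms when `V` is finite-dimensional and diagonalizable.
The projections on the factors with zero shift sum to the identity and do not appear.) -/
def dynShift (B : LinearMap.BilinForm ℂ 𝔥) (ρ : 𝔥 →ₗ[ℂ] Module.End ℂ V)
    (leg : Module.End ℂ V → Module.End ℂ (V ⊗[ℂ] (V ⊗[ℂ] V))) (c : ℂ)
    (f : 𝔥 → Module.End ℂ (V ⊗[ℂ] (V ⊗[ℂ] V))) (l : 𝔥) :
    Module.End ℂ (V ⊗[ℂ] (V ⊗[ℂ] V)) :=
  ∑ᶠ μ : 𝔥, leg (weightProj B ρ μ) * f (l + c • μ)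

/-- The modified (dynamical) Yang–Baxter equation with parameter `η`, an identity of
meromorphic functions of `(z₁, z₂, z₃, λ)` with values in `End (V ⊗ V ⊗ V)`. -/
def MYBE (B : LinearMap.BilinForm ℂ 𝔥) (ρ : 𝔥 →ₗ[ℂ] Module.End ℂ V) (η : ℂ)
    (R : ℂ → 𝔥 → Module.End ℂ (V ⊗[ℂ] V)) : Prop :=
  MeroEq
    (fun p : ℂ × ℂ × ℂ × 𝔥 =>
      dynShift B ρ leg3 η (fun l => leg12 (R (p.1 - p.2.1) l)) p.2.2.2 *
      dynShift B ρ leg2 (-η) (fun l => leg13 (R (p.1 - p.2.2.1) l)) p.2.2.2 *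
      dynShift B ρ leg1 η (fun l => leg23 (R (p.2.1 - p.2.2.1) l)) p.2.2.2)
    (fun p : ℂ × ℂ × ℂ × 𝔥 =>
      dynShift B ρ leg1 (-η) (fun l => leg23 (R (p.2.1 - p.2.2.1) l)) p.2.2.2 *
      dynShift B ρ leg2 η (fun l => leg13 (R (p.1 - p.2.2.1) l)) p.2.2.2 *
      dynShift B ρ leg3 (-η) (fun l => leg12 (R (p.1 - p.2.1) l)) p.2.2.2)

/-- Unitarity: `R⁽¹²⁾(z, λ) R⁽²¹⁾(-z, λ) = Id`. -/
def Unitary (R : ℂ → 𝔥 → Module.End ℂ (V ⊗[ℂ] V)) : Prop :=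
  MeroEq (fun p : ℂ × 𝔥 => R p.1 p.2 * leg21 (R (-p.1) p.2)) (fun _ => 1)

/-- The weight-zero condition: `[X⁽¹⁾ + X⁽²⁾, R(z, λ)] = 0` for all `X` in `𝔥`. -/
def WeightZero (ρ : 𝔥 →ₗ[ℂ] Module.End ℂ V) (R : ℂ → 𝔥 → Module.End ℂ (V ⊗[ℂ] V)) : Prop :=
  ∀ X : 𝔥, MeroEq
    (fun p : ℂ × 𝔥 =>
      (TensorProduct.map (ρ X) LinearMap.id + TensorProduct.map LinearMap.id (ρ X)) * R p.1 p.2)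
    (fun p : ℂ × 𝔥 =>
      R p.1 p.2 * (TensorProduct.map (ρ X) LinearMap.id + TensorProduct.map LinearMap.id (ρ X)))

/-- `R` is a generalized quantum R-matrix for the finite-dimensional diagonalizable `𝔥`-module
`V` and the parameter `η`: a meromorphic `End (V ⊗ V)`-valued function on `ℂ × 𝔥` that is a
unitary weight-zero solution of the modified Yang–Baxter equation. -/
structure IsGeneralizedRMatrix [FiniteDimensional ℂ V]
    (B : LinearMap.BilinForm ℂ 𝔥) (ρ : 𝔥 →ₗ[ℂ] Module.End ℂ V) (η : ℂ)
    (R : ℂ → 𝔥 → Module.End ℂ (V ⊗[ℂ] V)) : Prop where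
  diagonalizable : IsDiagonalizable B ρ
  meromorphic : IsMeromorphicVec fun p : ℂ × 𝔥 => R p.1 p.2
  mybe : MYBE B ρ η R
  unitary : Unitary R
  weightZero : WeightZero ρ R

end RMatrix

/-! ### Theta functions -/

/-- Jacobi's theta function
`θ₁(t, τ) = -∑_{j ∈ ℤ} exp(πi (j + 1/2)² τ + 2πi (j + 1/2)(t + 1/2))`. -/
def theta1 (t τ : ℂ) : ℂ :=
  -∑' j : ℤ, Complex.exp (Real.pi * Complex.I * ((j : ℂ) + 1 / 2) ^ 2 * τ +
    2 * Real.pi * Complex.I * ((j : ℂ) + 1 / 2) * (t + 1 / 2))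

/-- `σ(w, t) = θ₁(w - t, τ) ∂ₜθ₁(0, τ) / (θ₁(w, τ) θ₁(t, τ))`. -/
def sigma (τ w t : ℂ) : ℂ :=
  theta1 (w - t) τ * deriv (fun s => theta1 s τ) 0 / (theta1 w τ * theta1 t τ)

/-! ### The diagonal matrices and the elliptic R-matrix -/

/-- The abelian Lie algebra of diagonal `N × N` complex matrices, in the coordinates
`λ = diag(λ₁, …, λ_N)`, that is, through the linear embedding `Matrix.diagonal`. -/
abbrev Diag (N : ℕ) : Type := Fin N → ℂ

/-- The bilinear form `Trace(AB)` on diagonal matrices. -/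
def traceForm (N : ℕ) : LinearMap.BilinForm ℂ (Diag N) :=
  LinearMap.mk₂ ℂ (fun a b => Matrix.trace (Matrix.diagonal a * Matrix.diagonal b))
    (by
      intro a a' b
      rw [← Matrix.trace_add, ← add_mul, Matrix.diagonal_add]
      rfl)
    (by
      intro c a b
      rw [← Matrix.trace_smul, Matrix.diagonal_smul, Matrix.smul_mul])
    (by
      intro a b b'
      rw [← Matrix.trace_add, ← mul_add, Matrix.diagonal_add]
      rfl)
    (by
      intro c a b
      rw [← Matrix.trace_smul, Matrix.diagonal_smul, Matrix.mul_smul])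

/-- The action of the diagonal matrices on `V = ℂ^N`. -/
def diagAction (N : ℕ) : Diag N →ₗ[ℂ] Module.End ℂ (Fin N → ℂ) :=
  (Matrix.toLin' : Matrix (Fin N) (Fin N) ℂ ≃ₗ[ℂ] ((Fin N → ℂ) →ₗ[ℂ] (Fin N → ℂ))).toLinearMap ∘ₗ
    Matrix.diagonalLinearMap (Fin N) ℂ ℂ

/-- The elementary matrix `E_ij` as an endomorphism of `ℂ^N`. -/
def elem {N : ℕ} (i j : Fin N) : Module.End ℂ (Fin N → ℂ) :=
  Matrix.toLin' (Matrix.single i j (1 : ℂ))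

/-- `R(z, λ) = ∑_i E_ii ⊗ E_ii + ∑_{i ≠ j} (σ(γ, λ_ij) / σ(γ, z)) E_ii ⊗ E_jj
  + ∑_{i ≠ j} (σ(λ_ij, z) / σ(γ, z)) E_ij ⊗ E_ji`, where `λ_ij = λ_i - λ_j`. -/
def ellipticR (N : ℕ) (τ γ z : ℂ) (l : Diag N) :
    Module.End ℂ ((Fin N → ℂ) ⊗[ℂ] (Fin N → ℂ)) :=
  (∑ i : Fin N, TensorProduct.map (elem i i) (elem i i)) +
  (∑ i : Fin N, ∑ j : Fin N with i ≠ j,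
    (sigma τ γ (l i - l j) / sigma τ γ z) • TensorProduct.map (elem i i) (elem j j)) +
  (∑ i : Fin N, ∑ j : Fin N with i ≠ j,
    (sigma τ (l i - l j) z / sigma τ γ z) • TensorProduct.map (elem i j) (elem j i))

end EllipticRMatrix

end

/-!
# The elliptic dynamical R-matrix

All the identities reduce to two properties of `θ = θ₁(·, τ)`: it is odd, and it satisfies Fay's
trisecant identity
`θ(x+y)θ(x-y)θ(z+w)θ(z-w) - θ(x+z)θ(x-z)θ(y+w)θ(y-w) + θ(x+w)θ(x-w)θ(y+z)θ(y-z) = 0`.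
The latter comes from multiplying two theta series and splitting the double sum by parity:
`θ(x+y)θ(x-y) = A(x)B(y) - B(x)A(y)` with `A = thetaEven τ` and `B = thetaOdd τ`
(`theta1_add_mul_theta1_sub`), so the trisecant identity is a Plücker relation.

The same product formula shows `θ'(0) ≠ 0` (`deriv_theta1_zero_ne_zero`): otherwise the Wronskian
of `A` and `B` vanishes, `A` and `B` are proportional, and `θ` is identically zero, against
`θ(γ) ≠ 0`. Hence the factors `θ'(0)` cancel in the entries of `R`, which become
`diagCoef` and `exchCoef`, products and quotients of values of `θ`.

The weights of `V` are the basis vectors of `𝔥`, so on `e_a ⊗ e_b ⊗ e_c` a dynamical shift by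
`c h⁽ᵏ⁾` adds `c` to the coordinate of `λ` named by the `k`-th factor. The Yang–Baxter equation is
compared entry by entry. For distinct indices the shifts are invisible
(`yangBaxter_of_pairwise_ne`); if one index is repeated the differences `λ_a - λ_b ± γ / 2` occur,
which differ by `γ` (`yangBaxter_of_eq_of_ne`). In both cases the entries agree by the trisecant
identity.

The pointwise identities hold where certain theta functions of affine functions of `(z, λ)` do not
vanish; these points form an open dense set because `θ` is entire and not identically zero.
-/

namespace EllipticRMatrix

/-! ### Theta series -/

section Theta

open Complex

theorem theta1_eq_jacobiTheta₂ (t τ : ℂ) :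
    theta1 t τ = -(cexp (Real.pi * I * τ / 4 + Real.pi * I * (t + 1 / 2)) *
      jacobiTheta₂ (t + 1 / 2 + τ / 2) τ) := by
  rw [theta1, jacobiTheta₂, ← tsum_mul_left]
  congr 1
  refine tsum_congr fun j => ?_
  rw [jacobiTheta₂_term, ← Complex.exp_add]
  congr 1
  ring

theorem summable_norm_theta1_term (t : ℂ) {τ : ℂ} (hτ : 0 < τ.im) :
    Summable fun j : ℤ => ‖cexp (Real.pi * I * ((j : ℂ) + 1 / 2) ^ 2 * τ +
      2 * Real.pi * I * ((j : ℂ) + 1 / 2) * (t + 1 / 2))‖ := by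
  have h := ((summable_jacobiTheta₂_term_iff (t + 1 / 2 + τ / 2) τ).2 hτ).norm.mul_left
    ‖cexp (Real.pi * I * τ / 4 + Real.pi * I * (t + 1 / 2))‖
  refine h.congr fun j => ?_
  rw [← norm_mul, jacobiTheta₂_term, ← Complex.exp_add]
  congr 2
  ring

theorem differentiable_theta1 {τ : ℂ} (hτ : 0 < τ.im) :
    Differentiable ℂ fun t => theta1 t τ := by
  intro t
  simp only [theta1_eq_jacobiTheta₂]
  have h := (differentiableAt_jacobiTheta₂_fst (t + 1 / 2 + τ / 2) hτ).comp t
    (f := fun t : ℂ => t + 1 / 2 + τ / 2) (by fun_prop)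
  exact (DifferentiableAt.mul (by fun_prop) h).neg

/-- The series `∑ exp(πi m² τ / 2 + 2πi m x)` over the even integers `m = 2k`. -/
noncomputable def thetaEven (τ x : ℂ) : ℂ := jacobiTheta₂ (2 * x) (2 * τ)

/-- The series `∑ exp(πi m² τ / 2 + 2πi m x)` over the odd integers `m = 2k + 1`. The factor in
front of `jacobiTheta₂` comes from completing the square. -/
noncomputable def thetaOdd (τ x : ℂ) : ℂ :=
  cexp (Real.pi * I * τ / 2 + 2 * Real.pi * I * x) * jacobiTheta₂ (2 * x + τ) (2 * τ)

/-- A pair of integers `(j, k)` is determined by `(j + k + 1, j - k)`, one of which is even and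
the other odd. The two summands correspond to the two possibilities. -/
def parityEquiv : (ℤ × ℤ) ⊕ (ℤ × ℤ) ≃ ℤ × ℤ where
  toFun := Sum.elim (fun p => (p.1 + p.2, p.1 - p.2 - 1)) (fun p => (p.1 + p.2, p.1 - p.2))
  invFun p := if (p.1 + p.2) % 2 = 0 then Sum.inr ((p.1 + p.2) / 2, (p.1 - p.2) / 2)
    else Sum.inl ((p.1 + p.2 + 1) / 2, (p.1 - p.2 - 1) / 2)
  left_inv := by
    rintro (⟨p, q⟩ | ⟨p, q⟩)
    · have h : ¬ (p + q + (p - q - 1)) % 2 = 0 := by omega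
      simp only [Sum.elim_inl, h, if_false, Sum.inl.injEq, Prod.mk.injEq]
      omega
    · have h : (p + q + (p - q)) % 2 = 0 := by omega
      simp only [Sum.elim_inr, h, if_true, Sum.inr.injEq, Prod.mk.injEq]
      omega
  right_inv := by
    rintro ⟨j, k⟩
    by_cases h : (j + k) % 2 = 0
    · simp only [h, if_true, Sum.elim_inr, Prod.mk.injEq]
      omega
    · simp only [h, if_false, Sum.elim_inl, Prod.mk.injEq]
      omega

/-- In the double series for the left-hand side, the term with indices `j, k` has frequency
`m = j + k + 1` in `x` and `n = j - k` in `y`. Exactly one of `m`, `n` is odd, which splits the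
series in two products; the sign is `(-1)ᵐ`. -/
theorem theta1_add_mul_theta1_sub {τ : ℂ} (hτ : 0 < τ.im) (x y : ℂ) :
    theta1 (x + y) τ * theta1 (x - y) τ =
      thetaEven τ x * thetaOdd τ y - thetaOdd τ x * thetaEven τ y := by
  have h2τ : 0 < (2 * τ).im := by simpa using hτ
  have hE (x : ℂ) : Summable fun k : ℤ => ‖jacobiTheta₂_term k (2 * x) (2 * τ)‖ :=
    ((summable_jacobiTheta₂_term_iff _ _).2 h2τ).norm
  have hO (x : ℂ) : Summable fun k : ℤ =>
      ‖cexp (Real.pi * I * τ / 2 + 2 * Real.pi * I * x) *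
        jacobiTheta₂_term k (2 * x + τ) (2 * τ)‖ := by
    simp only [norm_mul]
    exact ((summable_jacobiTheta₂_term_iff _ _).2 h2τ).norm.mul_left _
  have h1 := summable_norm_theta1_term (x + y) hτ
  have h2 := summable_norm_theta1_term (x - y) hτ
  have tsum_odd (x : ℂ) : thetaOdd τ x = ∑' k : ℤ,
      cexp (Real.pi * I * τ / 2 + 2 * Real.pi * I * x) *
        jacobiTheta₂_term k (2 * x + τ) (2 * τ) := tsum_mul_left.symm
  rw [tsum_odd, tsum_odd, thetaEven, thetaEven, jacobiTheta₂, jacobiTheta₂, theta1, theta1,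
    neg_mul_neg, tsum_mul_tsum_of_summable_norm h1 h2,
    tsum_mul_tsum_of_summable_norm (hE x) (hO y), tsum_mul_tsum_of_summable_norm (hO x) (hE y),
    ← parityEquiv.tsum_eq, sub_eq_add_neg (tsum _), ← tsum_neg]
  have hs := parityEquiv.summable_iff.2 (summable_mul_of_summable_norm h1 h2)
  have key₁ (p : ℤ × ℤ) : cexp (Real.pi * I * (((parityEquiv (Sum.inl p)).1 : ℂ) + 1 / 2) ^ 2 * τ +
        2 * Real.pi * I * (((parityEquiv (Sum.inl p)).1 : ℂ) + 1 / 2) * (x + y + 1 / 2)) *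
      cexp (Real.pi * I * (((parityEquiv (Sum.inl p)).2 : ℂ) + 1 / 2) ^ 2 * τ +
        2 * Real.pi * I * (((parityEquiv (Sum.inl p)).2 : ℂ) + 1 / 2) * (x - y + 1 / 2)) =
      jacobiTheta₂_term p.1 (2 * x) (2 * τ) *
        (cexp (Real.pi * I * τ / 2 + 2 * Real.pi * I * y) *
          jacobiTheta₂_term p.2 (2 * y + τ) (2 * τ)) := by
    obtain ⟨p, q⟩ := p
    simp only [parityEquiv, Equiv.coe_fn_mk, Sum.elim_inl, jacobiTheta₂_term, ← Complex.exp_add]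
    rw [Complex.exp_eq_exp_iff_exists_int]
    -- The exponents differ by `2πi p`, the even frequency `2p` times `πi`.
    refine ⟨p, ?_⟩
    push_cast
    ring
  have key₂ (p : ℤ × ℤ) : cexp (Real.pi * I * (((parityEquiv (Sum.inr p)).1 : ℂ) + 1 / 2) ^ 2 * τ +
        2 * Real.pi * I * (((parityEquiv (Sum.inr p)).1 : ℂ) + 1 / 2) * (x + y + 1 / 2)) *
      cexp (Real.pi * I * (((parityEquiv (Sum.inr p)).2 : ℂ) + 1 / 2) ^ 2 * τ +
        2 * Real.pi * I * (((parityEquiv (Sum.inr p)).2 : ℂ) + 1 / 2) * (x - y + 1 / 2)) =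
      -(cexp (Real.pi * I * τ / 2 + 2 * Real.pi * I * x) *
          jacobiTheta₂_term p.1 (2 * x + τ) (2 * τ) *
        jacobiTheta₂_term p.2 (2 * y) (2 * τ)) := by
    obtain ⟨p, q⟩ := p
    simp only [parityEquiv, Equiv.coe_fn_mk, Sum.elim_inr, jacobiTheta₂_term, ← Complex.exp_add]
    rw [← neg_one_mul (cexp _), ← Complex.exp_pi_mul_I, ← Complex.exp_add,
      Complex.exp_eq_exp_iff_exists_int]
    refine ⟨p, ?_⟩
    push_cast
    ring
  rw [Summable.tsum_sum]
  · exact congrArg₂ _ (tsum_congr key₁) (tsum_congr key₂)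
  · exact hs.comp_injective Sum.inl_injective
  · exact hs.comp_injective Sum.inr_injective

/-- Fay's trisecant identity in genus one. After `theta1_add_mul_theta1_sub` it is the Plücker
relation between the `2 × 2` minors of a `2 × 4` matrix. -/
theorem theta1_three_term {τ : ℂ} (hτ : 0 < τ.im) (x y z w : ℂ) :
    theta1 (x + y) τ * theta1 (x - y) τ * (theta1 (z + w) τ * theta1 (z - w) τ) -
      theta1 (x + z) τ * theta1 (x - z) τ * (theta1 (y + w) τ * theta1 (y - w) τ) +
      theta1 (x + w) τ * theta1 (x - w) τ * (theta1 (y + z) τ * theta1 (y - z) τ) = 0 := by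
  simp only [theta1_add_mul_theta1_sub hτ]
  ring

theorem theta1_neg (t τ : ℂ) : theta1 (-t) τ = -theta1 t τ := by
  rw [theta1, theta1, neg_inj, ← tsum_neg]
  -- The substitution `j ↦ -j - 1` negates `j + 1 / 2`.
  rw [← (Equiv.subLeft (-1 : ℤ)).tsum_eq fun j : ℤ =>
    cexp (Real.pi * I * ((j : ℂ) + 1 / 2) ^ 2 * τ +
    2 * Real.pi * I * ((j : ℂ) + 1 / 2) * (-t + 1 / 2))]
  refine tsum_congr fun j => ?_
  rw [← neg_one_mul (cexp _), ← Complex.exp_pi_mul_I, ← Complex.exp_add,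
    Complex.exp_eq_exp_iff_exists_int]
  refine ⟨-j - 1, ?_⟩
  simp only [Equiv.subLeft_apply]
  push_cast
  ring

theorem differentiable_thetaEven {τ : ℂ} (hτ : 0 < τ.im) : Differentiable ℂ (thetaEven τ) := by
  intro x
  have h2τ : 0 < (2 * τ).im := by simpa using hτ
  exact (differentiableAt_jacobiTheta₂_fst (2 * x) h2τ).comp x
    (f := fun x : ℂ => 2 * x) (by fun_prop)

theorem differentiable_thetaOdd {τ : ℂ} (hτ : 0 < τ.im) : Differentiable ℂ (thetaOdd τ) := by
  intro x
  have h2τ : 0 < (2 * τ).im := by simpa using hτ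
  have h := (differentiableAt_jacobiTheta₂_fst (2 * x + τ) h2τ).comp x
    (f := fun x : ℂ => 2 * x + τ) (by fun_prop)
  exact DifferentiableAt.mul (by fun_prop) h

end Theta

/-! ### The zeros of the theta function -/

section Zeros

open Complex

theorem theta1_zero (τ : ℂ) : theta1 0 τ = 0 := by
  have h := theta1_neg 0 τ
  rw [neg_zero] at h
  exact self_eq_neg.1 h

/-- If the derivative vanished, the identity `theta1_add_mul_theta1_sub`, differentiated along
the diagonal, would make the Wronskian of `thetaEven` and `thetaOdd` vanish, so that these would
be proportional and the product `θ₁(x + y) θ₁(x - y)` identically zero. -/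
theorem deriv_theta1_zero_ne_zero {τ γ : ℂ} (hτ : 0 < τ.im) (hγ : theta1 γ τ ≠ 0) :
    deriv (fun s => theta1 s τ) 0 ≠ 0 := by
  intro h0
  have hA := differentiable_thetaEven hτ
  have hB := differentiable_thetaOdd hτ
  have hθ := differentiable_theta1 hτ
  have hF := theta1_add_mul_theta1_sub hτ
  have wronskian (x : ℂ) :
      thetaEven τ x * deriv (thetaOdd τ) x - thetaOdd τ x * deriv (thetaEven τ) x = 0 := by
    have h1 : HasDerivAt (fun y => theta1 (x + y) τ * theta1 (x - y) τ)
        (deriv (fun s => theta1 s τ) (x + x) * theta1 (x - x) τ +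
          theta1 (x + x) τ * -deriv (fun s => theta1 s τ) (x - x)) x := by
      refine HasDerivAt.mul ?_ ?_
      · exact HasDerivAt.comp_const_add (f := fun s => theta1 s τ) x x (hθ _).hasDerivAt
      · exact HasDerivAt.comp_const_sub (f := fun s => theta1 s τ) x x (hθ _).hasDerivAt
    have h2 : HasDerivAt (fun y => thetaEven τ x * thetaOdd τ y - thetaOdd τ x * thetaEven τ y)
        (thetaEven τ x * deriv (thetaOdd τ) x - thetaOdd τ x * deriv (thetaEven τ) x) x :=
      ((hB x).hasDerivAt.const_mul _).sub ((hA x).hasDerivAt.const_mul _)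
    have h3 := h2.unique (by simpa only [hF] using h1)
    rw [h3, sub_self, theta1_zero, h0]
    ring
  obtain ⟨x₀, hx₀⟩ : ∃ x, thetaOdd τ x ≠ 0 := by
    by_contra! hB0
    have h := hF γ 0
    rw [add_zero, sub_zero, hB0, hB0] at h
    exact mul_self_ne_zero.2 hγ (by rw [h]; ring)
  obtain ⟨r, hr, hball⟩ := Metric.isOpen_iff.1 (isOpen_ne_fun hB.continuous continuous_const) x₀ hx₀
  obtain ⟨c, hc⟩ : ∃ c, ∀ x ∈ Metric.ball x₀ r, thetaEven τ x / thetaOdd τ x = c := by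
    refine Metric.isOpen_ball.exists_is_const_of_deriv_eq_zero
      (convex_ball x₀ r).isPreconnected (fun x hx => ?_) fun x hx => ?_
    · exact ((hA x).div (hB x) (hball hx)).differentiableWithinAt
    · have := ((hA x).hasDerivAt.div (hB x).hasDerivAt (hball hx)).deriv
      refine this.trans ?_
      rw [Pi.zero_apply, div_eq_zero_iff]
      left
      linear_combination -wronskian x
  have hAB : thetaEven τ = fun x => c * thetaOdd τ x := by
    refine AnalyticOnNhd.eq_of_eventuallyEq (z₀ := x₀)
      (hA.differentiableOn.analyticOnNhd isOpen_univ)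
      ((hB.const_mul c).differentiableOn.analyticOnNhd isOpen_univ) ?_
    filter_upwards [Metric.ball_mem_nhds x₀ hr] with x hx
    exact (div_eq_iff (hball hx)).1 (hc x hx)
  have h := hF γ 0
  rw [add_zero, sub_zero, hAB] at h
  exact mul_self_ne_zero.2 hγ (by rw [h]; ring)

theorem dense_theta1_ne_zero {τ γ : ℂ} (hτ : 0 < τ.im) (hγ : theta1 γ τ ≠ 0) :
    Dense {t | theta1 t τ ≠ 0} := by
  intro t
  have h : AnalyticOnNhd ℂ (fun t => theta1 t τ) Set.univ :=
    (differentiable_theta1 hτ).differentiableOn.analyticOnNhd isOpen_univ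
  rw [mem_closure_iff_frequently]
  intro h0
  refine hγ (h.eqOn_zero_of_preconnected_of_eventuallyEq_zero isPreconnected_univ
    (Set.mem_univ t) ?_ (Set.mem_univ γ))
  filter_upwards [h0] with s hs
  simpa using hs

end Zeros

/-! ### Consequences of the trisecant identity -/

/-- An odd function satisfying Fay's trisecant identity. All the identities between the matrix
entries of the R-matrix follow from these two properties. -/
structure IsFay (θ : ℂ → ℂ) : Prop where
  odd : ∀ t, θ (-t) = -θ t
  three_term : ∀ x y z w, θ (x + y) * θ (x - y) * (θ (z + w) * θ (z - w)) -
    θ (x + z) * θ (x - z) * (θ (y + w) * θ (y - w)) +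
    θ (x + w) * θ (x - w) * (θ (y + z) * θ (y - z)) = 0

/-- The coefficient of `E_ii ⊗ E_jj` in the R-matrix, as a function of `x = λ_i - λ_j`. -/
noncomputable def diagCoef (θ : ℂ → ℂ) (γ z x : ℂ) : ℂ := θ (γ - x) * θ z / (θ x * θ (γ - z))

/-- The coefficient of `E_ij ⊗ E_ji` in the R-matrix, as a function of `x = λ_i - λ_j`. -/
noncomputable def exchCoef (θ : ℂ → ℂ) (γ z x : ℂ) : ℂ := θ (x - z) * θ γ / (θ x * θ (γ - z))

theorem diagCoef_mul_comm (θ : ℂ → ℂ) (γ u v x y : ℂ) :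
    diagCoef θ γ u x * diagCoef θ γ v y = diagCoef θ γ v x * diagCoef θ γ u y := by
  simp only [diagCoef]
  ring

namespace IsFay

variable {θ : ℂ → ℂ} (hθ : IsFay θ) {γ u v z x y : ℂ}
include hθ

theorem neg_sub (s t : ℂ) : θ (-s - t) = -θ (s + t) := by
  rw [← hθ.odd]
  congr 1
  ring

theorem sub_rev (s t : ℂ) : θ (s - t) = -θ (t - s) := by
  rw [← hθ.odd]
  congr 1
  ring

theorem unitarity_exch (hx : θ x ≠ 0) (h₁ : θ (γ - z) ≠ 0) (h₂ : θ (γ + z) ≠ 0) :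
    diagCoef θ γ (-z) (-x) * exchCoef θ γ z (-x) + exchCoef θ γ (-z) x * diagCoef θ γ z (-x) =
      0 := by
  simp only [diagCoef, exchCoef, sub_neg_eq_add, hθ.odd, hθ.neg_sub]
  field_simp
  ring

theorem unitarity_diag (hx : θ x ≠ 0) (h₁ : θ (γ - z) ≠ 0) (h₂ : θ (γ + z) ≠ 0) :
    diagCoef θ γ (-z) (-x) * diagCoef θ γ z x + exchCoef θ γ (-z) x * exchCoef θ γ z x = 1 := by
  have F := hθ.three_term γ x z 0
  simp only [add_zero, sub_zero] at F
  simp only [diagCoef, exchCoef, sub_neg_eq_add, hθ.odd]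
  field_simp
  linear_combination F

/-- The entry of the Yang–Baxter equation from `e_a ⊗ e_b ⊗ e_c` to `e_c ⊗ e_a ⊗ e_b`, where
`x = λ_a - λ_b` and `y = λ_b - λ_c`. -/
theorem exch_diag_exch (hx : θ x ≠ 0) (hy : θ y ≠ 0) (hxy : θ (x + y) ≠ 0)
    (hu : θ (γ - u) ≠ 0) (hv : θ (γ - v) ≠ 0) (hw : θ (γ - (u + v)) ≠ 0) :
    exchCoef θ γ v (-y) * diagCoef θ γ (u + v) x * exchCoef θ γ u (-(x + y)) =
      diagCoef θ γ u x * exchCoef θ γ (u + v) (-(x + y)) * exchCoef θ γ v x +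
        exchCoef θ γ u (-x) * exchCoef θ γ (u + v) (-y) * diagCoef θ γ v x := by
  have F : θ (x + y + u) * θ (y + v) * (θ (u + v) * θ x) -
      θ (x + y + (u + v)) * θ y * (θ u * θ (x - v)) -
      θ (y + (u + v)) * θ (x + y) * (θ (x + u) * θ v) = 0 := by
    -- The arguments are half sums and half differences of the arguments of `θ` in the first term.
    have F := hθ.three_term ((x + 2 * y + u + v) / 2) ((x + u - v) / 2) ((x + u + v) / 2)
      ((u + v - x) / 2)
    have e : (x + u - v) / 2 - (x + u + v) / 2 = -v := by ring
    rw [e, hθ.odd] at F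
    ring_nf at F ⊢
    exact F
  simp only [diagCoef, exchCoef, hθ.odd, hθ.neg_sub]
  field_simp
  linear_combination (θ (γ - x) * θ γ ^ 2) * F

/-- The entry of the Yang–Baxter equation from `e_a ⊗ e_b ⊗ e_c` to `e_b ⊗ e_c ⊗ e_a`, with
`x` and `y` as in `exch_diag_exch`. -/
theorem exch_diag_exch' (hx : θ x ≠ 0) (hy : θ y ≠ 0) (hxy : θ (x + y) ≠ 0)
    (hu : θ (γ - u) ≠ 0) (hv : θ (γ - v) ≠ 0) (hw : θ (γ - (u + v)) ≠ 0) :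
    diagCoef θ γ v y * exchCoef θ γ (u + v) (-(x + y)) * exchCoef θ γ u y +
        exchCoef θ γ v (-y) * exchCoef θ γ (u + v) (-x) * diagCoef θ γ u y =
      exchCoef θ γ u (-x) * diagCoef θ γ (u + v) y * exchCoef θ γ v (-(x + y)) := by
  rw [add_comm u v, add_comm x y] at *
  linear_combination -(hθ.exch_diag_exch hy hx hxy hv hu hw)

theorem three_term_diff (x y u v : ℂ) :
    θ (x + y + (u + v)) * θ (y - x) * (θ u * θ v) -
      θ (y + (u + v)) * θ y * (θ (x + u) * θ (x + v)) +
      θ (y + u) * θ (y + v) * (θ (x + (u + v)) * θ x) = 0 := by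
  have F := hθ.three_term (y + (u + v) / 2) (x + (u + v) / 2) ((u + v) / 2) ((u - v) / 2)
  ring_nf at F ⊢
  exact F

/-- The entry of the Yang–Baxter equation from `e_a ⊗ e_b ⊗ e_c` to `e_c ⊗ e_b ⊗ e_a`, with
`x` and `y` as in `exch_diag_exch`. -/
theorem exch_exch_exch (hx : θ x ≠ 0) (hy : θ y ≠ 0) (hxy : θ (x + y) ≠ 0)
    (hu : θ (γ - u) ≠ 0) (hv : θ (γ - v) ≠ 0) (hw : θ (γ - (u + v)) ≠ 0) :
    diagCoef θ γ v y * exchCoef θ γ (u + v) (-(x + y)) * diagCoef θ γ u (-y) +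
        exchCoef θ γ v (-y) * exchCoef θ γ (u + v) (-x) * exchCoef θ γ u (-y) =
      diagCoef θ γ u x * exchCoef θ γ (u + v) (-(x + y)) * diagCoef θ γ v (-x) +
        exchCoef θ γ u (-x) * exchCoef θ γ (u + v) (-y) * exchCoef θ γ v (-x) := by
  have F := hθ.three_term_diff x y u v
  have G := hθ.three_term γ x y 0
  rw [hθ.sub_rev x y] at G
  simp only [add_zero, sub_zero] at G
  simp only [diagCoef, exchCoef, hθ.odd, hθ.neg_sub, sub_neg_eq_add]
  field_simp
  linear_combination (θ γ ^ 3 * θ (x + y)) * F + (θ γ * θ u * θ v * θ (x + y + (u + v))) * G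

theorem three_term_shift (γ x u v : ℂ) :
    θ γ * θ (γ - x - (u + v)) * (θ v * θ (x - u)) -
      θ (γ - u) * θ (γ - x - v) * (θ x * θ (u + v)) +
      θ (γ - (u + v)) * θ (γ - x) * (θ (x + v) * θ u) = 0 := by
  have F := hθ.three_term (γ - (x + (u + v)) / 2) ((x + (u + v)) / 2) ((x - u + v) / 2)
    ((x - u - v) / 2)
  ring_nf at F ⊢
  linear_combination F

/-- The entry of the Yang–Baxter equation from `e_a ⊗ e_a ⊗ e_b` to `e_a ⊗ e_b ⊗ e_a`, where
`x = λ_a - λ_b + γ / 2`; the other shifted difference is `x - γ`. With `u` and `v` exchanged and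
`x = -(λ_a - λ_b - γ / 2)` it is the entry from `e_b ⊗ e_a ⊗ e_a` to `e_a ⊗ e_b ⊗ e_a`. -/
theorem shifted_exch_left (hx : θ x ≠ 0) (hy : θ (γ - x) ≠ 0)
    (hu : θ (γ - u) ≠ 0) (hv : θ (γ - v) ≠ 0) (hw : θ (γ - (u + v)) ≠ 0) :
    diagCoef θ γ v x * exchCoef θ γ (u + v) (γ - x) * exchCoef θ γ u x +
        exchCoef θ γ v (-x) * diagCoef θ γ u x =
      diagCoef θ γ (u + v) x * exchCoef θ γ v (γ - x) := by
  have F := hθ.three_term_shift γ x u v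
  simp only [diagCoef, exchCoef, hθ.odd, hθ.neg_sub]
  field_simp
  linear_combination θ γ * F

/-- The entry of the Yang–Baxter equation from `e_a ⊗ e_b ⊗ e_a` to `e_a ⊗ e_a ⊗ e_b`, where
`x = λ_a - λ_b - γ / 2`; the other shifted difference is `x + γ`. With `u` and `v` exchanged and
`x = -(λ_a - λ_b + γ / 2)` it is the entry from `e_a ⊗ e_b ⊗ e_a` to `e_b ⊗ e_a ⊗ e_a`. -/
theorem shifted_exch_middle (hx : θ x ≠ 0) (hy : θ (γ + x) ≠ 0)
    (hu : θ (γ - u) ≠ 0) (hv : θ (γ - v) ≠ 0) (hw : θ (γ - (u + v)) ≠ 0) :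
    exchCoef θ γ v (γ + x) * diagCoef θ γ (u + v) x =
      diagCoef θ γ u x * exchCoef θ γ v x +
        exchCoef θ γ u (-x) * exchCoef θ γ (u + v) (γ + x) * diagCoef θ γ v x := by
  have F := hθ.three_term_shift γ (-x) u v
  rw [neg_add_eq_sub, hθ.sub_rev v x, hθ.odd, hθ.neg_sub] at F
  simp only [sub_neg_eq_add] at F
  simp only [diagCoef, exchCoef, hθ.odd, hθ.neg_sub]
  field_simp
  linear_combination (θ γ * θ (γ - x)) * F

/-- The entry of the Yang–Baxter equation from `e_a ⊗ e_a ⊗ e_b` to `e_b ⊗ e_a ⊗ e_a`, where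
`x = λ_a - λ_b + γ / 2`. With `u` and `v` exchanged and `x = -(λ_a - λ_b - γ / 2)` it is the entry
from `e_b ⊗ e_a ⊗ e_a` to `e_a ⊗ e_a ⊗ e_b`. -/
theorem shifted_exch_right (hx : θ x ≠ 0) (hy : θ (γ - x) ≠ 0)
    (hu : θ (γ - u) ≠ 0) (hv : θ (γ - v) ≠ 0) (hw : θ (γ - (u + v)) ≠ 0) :
    diagCoef θ γ v x * exchCoef θ γ (u + v) (γ - x) * diagCoef θ γ u (-x) +
        exchCoef θ γ v (-x) * exchCoef θ γ u (-x) =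
      exchCoef θ γ (u + v) (-x) := by
  have F : θ (γ + x) * θ (γ - x - (u + v)) * (θ u * θ v) -
      θ γ * θ (γ - (u + v)) * (θ (x + u) * θ (x + v)) +
      θ (γ - v) * θ (γ - u) * (θ (x + (u + v)) * θ x) = 0 := by
    have F := hθ.three_term (γ - (u + v) / 2) (x + (u + v) / 2) ((u + v) / 2) ((u - v) / 2)
    ring_nf at F ⊢
    exact F
  simp only [diagCoef, exchCoef, hθ.odd, hθ.neg_sub, sub_neg_eq_add]
  field_simp
  linear_combination (-θ γ) * F

/-- The diagonal entry of the Yang–Baxter equation at `e_a ⊗ e_b ⊗ e_a`, where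
`x = λ_a - λ_b + γ / 2`. -/
theorem shifted_diag (hx : θ x ≠ 0) (hy : θ (γ - x) ≠ 0)
    (hu : θ (γ - u) ≠ 0) (hv : θ (γ - v) ≠ 0) (hw : θ (γ - (u + v)) ≠ 0) :
    diagCoef θ γ v (-x) * diagCoef θ γ u x +
        exchCoef θ γ v x * exchCoef θ γ (u + v) (γ - x) * exchCoef θ γ u x =
      diagCoef θ γ u (x - γ) * diagCoef θ γ v (γ - x) +
        exchCoef θ γ u (γ - x) * exchCoef θ γ (u + v) x * exchCoef θ γ v (γ - x) := by
  have F : θ (γ - (u + v)) * θ (x - (γ - x)) * (θ u * θ v) -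
      θ x * θ (x - (u + v)) * (θ (γ - x - u) * θ (γ - x - v)) +
      θ (x - u) * θ (x - v) * (θ (γ - x) * θ (γ - x - (u + v))) = 0 := by
    have F := hθ.three_term (x - (u + v) / 2) (γ - x - (u + v) / 2) ((u + v) / 2) ((u - v) / 2)
    ring_nf at F ⊢
    exact F
  have G := hθ.three_term γ x (γ - x) 0
  rw [sub_sub_cancel, add_sub_cancel] at G
  simp only [add_zero, sub_zero] at G
  rw [show x - γ = -(γ - x) by ring]
  simp only [diagCoef, exchCoef, hθ.odd, sub_neg_eq_add, sub_sub_cancel]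
  field_simp
  linear_combination θ γ ^ 3 * F - (θ u * θ v * θ (γ - (u + v))) * G

end IsFay

/-! ### Weight spaces and dynamical shifts -/

section Weights

variable {N : ℕ}

theorem traceForm_apply (μ X : Diag N) : traceForm N μ X = ∑ k, μ k * X k := by
  simp [traceForm, Matrix.trace, Matrix.diagonal_mul_diagonal]

theorem diagAction_apply (X : Diag N) (v : Fin N → ℂ) (k : Fin N) :
    diagAction N X v k = X k * v k := by
  simp [diagAction, Matrix.mulVec_diagonal]

theorem elem_single (i j k : Fin N) :
    elem i j (Pi.single k 1) = if j = k then (Pi.single i 1 : Fin N → ℂ) else 0 := by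
  split_ifs with h <;> ext m <;> simp [elem, Matrix.single_apply, Pi.single_apply, h, eq_comm]

/-- The weight space `V[μ]` is spanned by the `k`-th basis vector if `μ` is the `k`-th basis
vector, and is zero if `μ` is not a basis vector. -/
theorem mem_weightSpace_iff {μ : Diag N} {v : Fin N → ℂ} :
    v ∈ weightSpace (traceForm N) (diagAction N) μ ↔
      ∀ k, μ ≠ Pi.single k 1 → v k = 0 := by
  constructor
  · intro hv k hk
    by_contra hvk
    refine hk (funext fun m => ?_)
    have h := congrFun (hv (Pi.single m 1)) k
    rw [diagAction_apply, Pi.smul_apply, smul_eq_mul, traceForm_apply] at h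
    have h' := mul_right_cancel₀ hvk h
    simpa [Pi.single_apply, eq_comm] using h'.symm
  · intro hv X
    ext k
    rw [diagAction_apply, Pi.smul_apply, smul_eq_mul, traceForm_apply]
    by_cases hk : μ = Pi.single k 1
    · simp [hk, Pi.single_apply]
    · simp [hv k hk]

theorem single_mem_weightSpace (k : Fin N) : (Pi.single k 1 : Fin N → ℂ) ∈
    weightSpace (traceForm N) (diagAction N) (Pi.single k 1) := by
  rw [mem_weightSpace_iff]
  intro m hm
  rw [Pi.single_eq_of_ne]
  rintro rfl
  exact hm rfl

theorem iSup_weightSpace_ne_le (μ : Diag N) {v : Fin N → ℂ}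
    (hv : v ∈ ⨆ ν, ⨆ _ : ν ≠ μ, weightSpace (traceForm N) (diagAction N) ν) {k : Fin N}
    (hk : μ = Pi.single k 1) : v k = 0 := by
  have hle : (⨆ ν, ⨆ _ : ν ≠ μ, weightSpace (traceForm N) (diagAction N) ν) ≤
      LinearMap.ker (LinearMap.proj (R := ℂ) (φ := fun _ : Fin N => ℂ) k) := by
    refine iSup₂_le fun ν hν w hw => ?_
    exact mem_weightSpace_iff.1 hw k (hk ▸ hν)
  exact hle hv

theorem eq_top_of_single_mem (p : Submodule ℂ (Fin N → ℂ))
    (h : ∀ k, (Pi.single k 1 : Fin N → ℂ) ∈ p) : p = ⊤ := by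
  rw [eq_top_iff, ← (Pi.basisFun ℂ (Fin N)).span_eq, Submodule.span_le]
  rintro _ ⟨k, rfl⟩
  simpa using h k

theorem isCompl_weightSpace (μ : Diag N) :
    IsCompl (weightSpace (traceForm N) (diagAction N) μ)
      (⨆ ν, ⨆ _ : ν ≠ μ, weightSpace (traceForm N) (diagAction N) ν) := by
  constructor
  · rw [Submodule.disjoint_def]
    intro v hv hv'
    ext k
    by_cases hk : μ = Pi.single k 1
    · exact iSup_weightSpace_ne_le μ hv' hk
    · exact mem_weightSpace_iff.1 hv k hk
  · rw [codisjoint_iff]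
    refine eq_top_of_single_mem _ fun k => ?_
    by_cases hk : Pi.single k 1 = μ
    · exact Submodule.mem_sup_left (hk ▸ single_mem_weightSpace k)
    · exact Submodule.mem_sup_right
        (Submodule.mem_iSup_of_mem _ (Submodule.mem_iSup_of_mem hk (single_mem_weightSpace k)))

theorem isDiagonalizable_diagAction (N : ℕ) : IsDiagonalizable (traceForm N) (diagAction N) :=
  ⟨fun μ => (isCompl_weightSpace μ).disjoint, eq_top_of_single_mem _ fun k =>
    Submodule.mem_iSup_of_mem _ (single_mem_weightSpace k)⟩

theorem weightProj_single (μ : Diag N) (k : Fin N) :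
    weightProj (traceForm N) (diagAction N) μ (Pi.single k 1) =
      if μ = Pi.single k 1 then (Pi.single k 1 : Fin N → ℂ) else 0 := by
  rw [weightProj, dif_pos (isCompl_weightSpace μ)]
  split_ifs with h
  · exact Submodule.projection_apply_of_mem_left _ (h ▸ single_mem_weightSpace k)
  · rw [Submodule.projection_apply_eq_zero_iff]
    exact Submodule.mem_iSup_of_mem _ (Submodule.mem_iSup_of_mem (Ne.symm h)
      (single_mem_weightSpace k))

theorem weightProj_single_eq_elem (k : Fin N) :
    weightProj (traceForm N) (diagAction N) (Pi.single k 1) = elem k k := by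
  refine (Pi.basisFun ℂ (Fin N)).ext fun m => ?_
  rw [Pi.basisFun_apply, weightProj_single, elem_single]
  by_cases h : k = m
  · simp [h]
  · have h' : (Pi.single k 1 : Fin N → ℂ) ≠ Pi.single m 1 := fun e => h
      (by simpa [Pi.single_apply, eq_comm] using congrFun e k)
    rw [if_neg h, if_neg h']

theorem weightProj_eq_zero {μ : Diag N} (h : ∀ k, μ ≠ Pi.single k 1) :
    weightProj (traceForm N) (diagAction N) μ = 0 := by
  refine (Pi.basisFun ℂ (Fin N)).ext fun m => ?_
  rw [Pi.basisFun_apply, weightProj_single, if_neg (h m), LinearMap.zero_apply]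

/-- Only the weights of `V`, the basis vectors of `𝔥`, contribute to the dynamical shift. -/
theorem dynShift_eq_sum {leg : Module.End ℂ (Fin N → ℂ) →
      Module.End ℂ ((Fin N → ℂ) ⊗[ℂ] ((Fin N → ℂ) ⊗[ℂ] (Fin N → ℂ)))} (hleg : leg 0 = 0) (c : ℂ)
    (f : Diag N → Module.End ℂ ((Fin N → ℂ) ⊗[ℂ] ((Fin N → ℂ) ⊗[ℂ] (Fin N → ℂ)))) (l : Diag N) :
    dynShift (traceForm N) (diagAction N) leg c f l =
      ∑ k : Fin N, leg (elem k k) * f (l + c • (Pi.single k 1 : Diag N)) := by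
  have hinj : Function.Injective fun k : Fin N => (Pi.single k 1 : Diag N) := by
    intro k m e
    simpa [Pi.single_apply, eq_comm] using congrFun e k
  rw [dynShift, finsum_eq_sum_of_support_subset (s := Finset.univ.map ⟨_, hinj⟩), Finset.sum_map]
  · simp [weightProj_single_eq_elem]
  · intro μ hμ
    by_contra hμ'
    refine hμ ?_
    simp only
    rw [weightProj_eq_zero, hleg, zero_mul]
    rintro k rfl
    simp at hμ'

end Weights

/-! ### Operators on different tensor factors commute -/

section Legs

variable {V : Type*} [AddCommGroup V] [Module ℂ V]

theorem leg3_mul_leg12 (A : Module.End ℂ V) (T : Module.End ℂ (V ⊗[ℂ] V)) :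
    leg3 A * leg12 T = leg12 T * leg3 A := by
  have h : leg3 A = (TensorProduct.assoc ℂ V V V).toLinearMap ∘ₗ
      TensorProduct.map LinearMap.id A ∘ₗ (TensorProduct.assoc ℂ V V V).symm.toLinearMap := by
    ext x y z
    simp [leg3]
  rw [h]
  refine LinearMap.ext fun t => ?_
  obtain ⟨s, rfl⟩ := (TensorProduct.assoc ℂ V V V).surjective t
  simp only [leg12, Module.End.mul_apply, LinearMap.comp_apply, LinearEquiv.coe_coe,
    LinearEquiv.symm_apply_apply]
  simp only [← LinearMap.comp_apply, ← TensorProduct.map_comp, LinearMap.id_comp,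
    LinearMap.comp_id]

theorem leg2_mul_leg13 (A : Module.End ℂ V) (T : Module.End ℂ (V ⊗[ℂ] V)) :
    leg2 A * leg13 T = leg13 T * leg2 A := by
  have h₁ : leg2 A * swap23 = swap23 * leg3 A := by
    ext x y z
    simp [leg2, leg3, swap23]
  have h₂ : leg3 A * swap23 = swap23 * leg2 A := by
    ext x y z
    simp [leg2, leg3, swap23]
  change leg2 A * (swap23 * (leg12 T * swap23)) = swap23 * (leg12 T * swap23) * leg2 A
  rw [← mul_assoc, h₁, mul_assoc, ← mul_assoc (leg3 A), leg3_mul_leg12, mul_assoc, h₂]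
  simp only [mul_assoc]

theorem leg1_mul_leg23 (A : Module.End ℂ V) (T : Module.End ℂ (V ⊗[ℂ] V)) :
    leg1 A * leg23 T = leg23 T * leg1 A := by
  simp only [leg1, leg23, Module.End.mul_eq_comp, ← TensorProduct.map_comp, LinearMap.id_comp,
    LinearMap.comp_id]

end Legs

/-! ### Matrix entries -/

section Entries

variable {N : ℕ}

/-- The basis vector `e_a ⊗ e_b` of `V ⊗ V`. -/
noncomputable def basis2 (a b : Fin N) : (Fin N → ℂ) ⊗[ℂ] (Fin N → ℂ) :=
  Pi.single a 1 ⊗ₜ[ℂ] Pi.single b 1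

/-- The basis vector `e_a ⊗ e_b ⊗ e_c` of `V ⊗ V ⊗ V`. -/
noncomputable def basis3 (a b c : Fin N) :
    (Fin N → ℂ) ⊗[ℂ] ((Fin N → ℂ) ⊗[ℂ] (Fin N → ℂ)) :=
  Pi.single a 1 ⊗ₜ[ℂ] (Pi.single b 1 ⊗ₜ[ℂ] Pi.single c 1)

theorem ext_basis2 {T S : Module.End ℂ ((Fin N → ℂ) ⊗[ℂ] (Fin N → ℂ))}
    (h : ∀ a b, T (basis2 a b) = S (basis2 a b)) : T = S := by
  refine ((Pi.basisFun ℂ (Fin N)).tensorProduct (Pi.basisFun ℂ (Fin N))).ext ?_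
  rintro ⟨a, b⟩
  simpa [Module.Basis.tensorProduct_apply, basis2, basis3] using h a b

theorem ext_basis3 {T S : Module.End ℂ ((Fin N → ℂ) ⊗[ℂ] ((Fin N → ℂ) ⊗[ℂ] (Fin N → ℂ)))}
    (h : ∀ a b c, T (basis3 a b c) = S (basis3 a b c)) : T = S := by
  refine ((Pi.basisFun ℂ (Fin N)).tensorProduct
    ((Pi.basisFun ℂ (Fin N)).tensorProduct (Pi.basisFun ℂ (Fin N)))).ext ?_
  rintro ⟨a, b, c⟩
  simpa [Module.Basis.tensorProduct_apply, basis2, basis3] using h a b c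

theorem map_elem_basis2 (i j k m a b : Fin N) :
    TensorProduct.map (elem i j) (elem k m) (basis2 a b) =
      if j = a ∧ m = b then basis2 i k else 0 := by
  rw [basis2, TensorProduct.map_tmul, elem_single, elem_single]
  by_cases h₁ : j = a <;> by_cases h₂ : m = b <;> simp [h₁, h₂, basis2]

theorem sum_sum_ne_eq_single {M : Type*} [AddCommMonoid M] (f : Fin N → Fin N → M) (a b : Fin N)
    (h : ∀ i j, ¬(i = a ∧ j = b) → f i j = 0) :
    ∑ i : Fin N, ∑ j : Fin N with i ≠ j, f i j = if a = b then 0 else f a b := by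
  simp only [Finset.sum_filter]
  rw [Fintype.sum_eq_single a, Fintype.sum_eq_single b]
  · split_ifs with h₁ h₂ <;> simp_all
  · intro j hj
    rw [h a j fun e => hj e.2, ite_self]
  · intro i hi
    refine Finset.sum_eq_zero fun j _ => ?_
    rw [h i j fun e => hi e.1, ite_self]

theorem ellipticR_basis2 (τ γ z : ℂ) (l : Diag N) (a b : Fin N) :
    ellipticR N τ γ z l (basis2 a b) =
      (if a = b then basis2 a b else 0) +
      (if a = b then 0 else (sigma τ γ (l a - l b) / sigma τ γ z) • basis2 a b) +
      (if b = a then 0 else (sigma τ (l b - l a) z / sigma τ γ z) • basis2 b a) := by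
  simp only [ellipticR, LinearMap.add_apply, LinearMap.sum_apply, LinearMap.smul_apply,
    map_elem_basis2]
  congr 1
  · congr 1
    · rw [Fintype.sum_eq_single a]
      · by_cases h : a = b <;> simp [h]
      · intro i hi
        rw [if_neg fun e => hi e.1]
    · rw [sum_sum_ne_eq_single _ a b]
      · simp
      · intro i j hij
        rw [if_neg hij, smul_zero]
  · rw [sum_sum_ne_eq_single _ b a]
    · simp
    · intro i j hij
      rw [if_neg fun e => hij e.symm, smul_zero]

theorem ellipticR_basis2_self (τ γ z : ℂ) (l : Diag N) (a : Fin N) :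
    ellipticR N τ γ z l (basis2 a a) = basis2 a a := by
  simp [ellipticR_basis2]

/-- The factor `∂ₜθ₁(0)` cancels because it is nonzero. No hypothesis on `x`, `z`
or `γ - z` is needed: where one of their theta functions vanishes, both sides are zero by the
convention on division by zero. -/
theorem sigma_div_sigma_diag {τ γ : ℂ} (hτ : 0 < τ.im) (hγ : theta1 γ τ ≠ 0) (z x : ℂ) :
    sigma τ γ x / sigma τ γ z = diagCoef (theta1 · τ) γ z x := by
  have h0 := deriv_theta1_zero_ne_zero hτ hγ
  rw [sigma, sigma, diagCoef, div_div_div_eq,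
    ← mul_div_mul_left (theta1 (γ - x) τ * _) _ (mul_ne_zero h0 hγ)]
  congr 1 <;> ring

theorem sigma_div_sigma_exch {τ γ z : ℂ} (hτ : 0 < τ.im) (hγ : theta1 γ τ ≠ 0)
    (hz : theta1 z τ ≠ 0) (x : ℂ) :
    sigma τ x z / sigma τ γ z = exchCoef (theta1 · τ) γ z x := by
  have h0 := deriv_theta1_zero_ne_zero hτ hγ
  rw [sigma, sigma, exchCoef, div_div_div_eq,
    ← mul_div_mul_left (theta1 (x - z) τ * _) _ (mul_ne_zero h0 hz)]
  congr 1 <;> ring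

theorem ellipticR_basis2_of_ne {τ γ z : ℂ} (hτ : 0 < τ.im) (hγ : theta1 γ τ ≠ 0)
    (hz : theta1 z τ ≠ 0) (l : Diag N) {a b : Fin N} (hab : a ≠ b) :
    ellipticR N τ γ z l (basis2 a b) =
      diagCoef (theta1 · τ) γ z (l a - l b) • basis2 a b +
        exchCoef (theta1 · τ) γ z (-(l a - l b)) • basis2 b a := by
  rw [ellipticR_basis2, if_neg hab, if_neg hab, if_neg hab.symm, zero_add,
    sigma_div_sigma_diag hτ hγ, sigma_div_sigma_exch hτ hγ hz, neg_sub]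

/-- `R⁽¹²⁾(z, λ + c h⁽³⁾)`. -/
noncomputable def shiftedR12 (N : ℕ) (τ γ c z : ℂ) (l : Diag N) :
    Module.End ℂ ((Fin N → ℂ) ⊗[ℂ] ((Fin N → ℂ) ⊗[ℂ] (Fin N → ℂ))) :=
  dynShift (traceForm N) (diagAction N) leg3 c (fun l => leg12 (ellipticR N τ γ z l)) l

/-- `R⁽¹³⁾(z, λ + c h⁽²⁾)`. -/
noncomputable def shiftedR13 (N : ℕ) (τ γ c z : ℂ) (l : Diag N) :
    Module.End ℂ ((Fin N → ℂ) ⊗[ℂ] ((Fin N → ℂ) ⊗[ℂ] (Fin N → ℂ))) :=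
  dynShift (traceForm N) (diagAction N) leg2 c (fun l => leg13 (ellipticR N τ γ z l)) l

/-- `R⁽²³⁾(z, λ + c h⁽¹⁾)`. -/
noncomputable def shiftedR23 (N : ℕ) (τ γ c z : ℂ) (l : Diag N) :
    Module.End ℂ ((Fin N → ℂ) ⊗[ℂ] ((Fin N → ℂ) ⊗[ℂ] (Fin N → ℂ))) :=
  dynShift (traceForm N) (diagAction N) leg1 c (fun l => leg23 (ellipticR N τ γ z l)) l

theorem shiftedR12_basis3 (τ γ c z : ℂ) (l : Diag N) (i j k : Fin N) :
    shiftedR12 N τ γ c z l (basis3 i j k) =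
      leg12 (ellipticR N τ γ z (l + c • (Pi.single k 1 : Diag N))) (basis3 i j k) := by
  rw [shiftedR12, dynShift_eq_sum (by simp [leg3]), LinearMap.sum_apply, Fintype.sum_eq_single k]
  · rw [leg3_mul_leg12]
    simp [leg3, basis3, elem_single]
  · intro m hm
    rw [leg3_mul_leg12]
    simp [leg3, basis3, elem_single, hm]

theorem shiftedR13_basis3 (τ γ c z : ℂ) (l : Diag N) (i j k : Fin N) :
    shiftedR13 N τ γ c z l (basis3 i j k) =
      leg13 (ellipticR N τ γ z (l + c • (Pi.single j 1 : Diag N))) (basis3 i j k) := by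
  rw [shiftedR13, dynShift_eq_sum (by simp [leg2]), LinearMap.sum_apply, Fintype.sum_eq_single j]
  · rw [leg2_mul_leg13]
    simp [leg2, basis3, elem_single]
  · intro m hm
    rw [leg2_mul_leg13]
    simp [leg2, basis3, elem_single, hm]

theorem shiftedR23_basis3 (τ γ c z : ℂ) (l : Diag N) (i j k : Fin N) :
    shiftedR23 N τ γ c z l (basis3 i j k) =
      leg23 (ellipticR N τ γ z (l + c • (Pi.single i 1 : Diag N))) (basis3 i j k) := by
  rw [shiftedR23, dynShift_eq_sum (by simp [leg1]), LinearMap.sum_apply, Fintype.sum_eq_single i]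
  · rw [leg1_mul_leg23]
    simp [leg1, basis3, elem_single]
  · intro m hm
    rw [leg1_mul_leg23]
    simp [leg1, basis3, elem_single, hm]

theorem leg12_basis3 {T : Module.End ℂ ((Fin N → ℂ) ⊗[ℂ] (Fin N → ℂ))} {i j i' j' : Fin N}
    {s t : ℂ} (h : T (basis2 i j) = s • basis2 i j + t • basis2 i' j') (k : Fin N) :
    leg12 T (basis3 i j k) = s • basis3 i j k + t • basis3 i' j' k := by
  simp only [basis2] at h
  simp [leg12, basis3, h, TensorProduct.add_tmul, ← TensorProduct.smul_tmul']

theorem leg13_basis3 {T : Module.End ℂ ((Fin N → ℂ) ⊗[ℂ] (Fin N → ℂ))} {i j i' j' : Fin N}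
    {s t : ℂ} (h : T (basis2 i j) = s • basis2 i j + t • basis2 i' j') (k : Fin N) :
    leg13 T (basis3 i k j) = s • basis3 i k j + t • basis3 i' k j' := by
  have h' := leg12_basis3 h k
  simp only [basis3] at h'
  simp [leg13, basis3, swap23, h']

theorem leg23_basis3 {T : Module.End ℂ ((Fin N → ℂ) ⊗[ℂ] (Fin N → ℂ))} {i j i' j' : Fin N}
    {s t : ℂ} (h : T (basis2 i j) = s • basis2 i j + t • basis2 i' j') (k : Fin N) :
    leg23 T (basis3 k i j) = s • basis3 k i j + t • basis3 k i' j' := by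
  simp only [basis2] at h
  simp [leg23, basis3, h, TensorProduct.tmul_add]

end Entries

/-! ### The Yang–Baxter equation, unitarity and weight zero -/

section YangBaxter

variable {N : ℕ} {τ γ z : ℂ}

theorem isFay_theta1 (hτ : 0 < τ.im) : IsFay (theta1 · τ) :=
  ⟨fun t => theta1_neg t τ, theta1_three_term hτ⟩

theorem shiftedR12_of_ne (hτ : 0 < τ.im) (hγ : theta1 γ τ ≠ 0) (hz : theta1 z τ ≠ 0) {c d : ℂ}
    {l : Diag N} {i j k : Fin N} (hij : i ≠ j)
    (hd : (l + c • (Pi.single k 1 : Diag N)) i - (l + c • (Pi.single k 1 : Diag N)) j = d) :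
    shiftedR12 N τ γ c z l (basis3 i j k) =
      diagCoef (theta1 · τ) γ z d • basis3 i j k +
        exchCoef (theta1 · τ) γ z (-d) • basis3 j i k := by
  rw [shiftedR12_basis3, ← hd]
  exact leg12_basis3 (ellipticR_basis2_of_ne hτ hγ hz _ hij) k

theorem shiftedR13_of_ne (hτ : 0 < τ.im) (hγ : theta1 γ τ ≠ 0) (hz : theta1 z τ ≠ 0) {c d : ℂ}
    {l : Diag N} {i j k : Fin N} (hik : i ≠ k)
    (hd : (l + c • (Pi.single j 1 : Diag N)) i - (l + c • (Pi.single j 1 : Diag N)) k = d) :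
    shiftedR13 N τ γ c z l (basis3 i j k) =
      diagCoef (theta1 · τ) γ z d • basis3 i j k +
        exchCoef (theta1 · τ) γ z (-d) • basis3 k j i := by
  rw [shiftedR13_basis3, ← hd]
  exact leg13_basis3 (ellipticR_basis2_of_ne hτ hγ hz _ hik) j

theorem shiftedR23_of_ne (hτ : 0 < τ.im) (hγ : theta1 γ τ ≠ 0) (hz : theta1 z τ ≠ 0) {c d : ℂ}
    {l : Diag N} {i j k : Fin N} (hjk : j ≠ k)
    (hd : (l + c • (Pi.single i 1 : Diag N)) j - (l + c • (Pi.single i 1 : Diag N)) k = d) :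
    shiftedR23 N τ γ c z l (basis3 i j k) =
      diagCoef (theta1 · τ) γ z d • basis3 i j k +
        exchCoef (theta1 · τ) γ z (-d) • basis3 i k j := by
  rw [shiftedR23_basis3, ← hd]
  exact leg23_basis3 (ellipticR_basis2_of_ne hτ hγ hz _ hjk) i

/-- The form of `ellipticR_basis2_self` to which `leg12_basis3` and its analogues apply. -/
theorem ellipticR_basis2_self' (τ γ z : ℂ) (l : Diag N) (a : Fin N) :
    ellipticR N τ γ z l (basis2 a a) = (1 : ℂ) • basis2 a a + (0 : ℂ) • basis2 a a := by
  rw [ellipticR_basis2_self, one_smul, zero_smul, add_zero]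

theorem shiftedR12_self (τ γ c z : ℂ) (l : Diag N) (i k : Fin N) :
    shiftedR12 N τ γ c z l (basis3 i i k) = basis3 i i k := by
  rw [shiftedR12_basis3, leg12_basis3 (ellipticR_basis2_self' ..), one_smul, zero_smul, add_zero]

theorem shiftedR13_self (τ γ c z : ℂ) (l : Diag N) (i k : Fin N) :
    shiftedR13 N τ γ c z l (basis3 i k i) = basis3 i k i := by
  rw [shiftedR13_basis3, leg13_basis3 (ellipticR_basis2_self' ..), one_smul, zero_smul, add_zero]

theorem shiftedR23_self (τ γ c z : ℂ) (l : Diag N) (i k : Fin N) :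
    shiftedR23 N τ γ c z l (basis3 k i i) = basis3 k i i := by
  rw [shiftedR23_basis3, leg23_basis3 (ellipticR_basis2_self' ..), one_smul, zero_smul, add_zero]

/-- The points `λ` at which no theta function in a denominator of the modified Yang–Baxter
equation vanishes. Exchanging `a` and `b` covers the shift by `-γ / 2`. -/
def IsGeneric (τ γ : ℂ) (l : Diag N) : Prop :=
  ∀ a b, a ≠ b → theta1 (l a - l b) τ ≠ 0 ∧ theta1 (l a - l b + γ / 2) τ ≠ 0

/-- The spectral parameters `z` at which neither `θ₁(z)` nor `θ₁(γ - z)` vanishes. -/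
def IsRegular (τ γ z : ℂ) : Prop := theta1 z τ ≠ 0 ∧ theta1 (γ - z) τ ≠ 0

variable {u v : ℂ} {l : Diag N}

/-- On `e_a ⊗ e_b ⊗ e_c` with distinct indices the shifts leave all the differences `λ_i - λ_j`
that occur unchanged, and `η` plays no role. -/
theorem yangBaxter_of_pairwise_ne (hτ : 0 < τ.im) (hγ : theta1 γ τ ≠ 0) (hu : IsRegular τ γ u)
    (hv : IsRegular τ γ v) (hw : IsRegular τ γ (u + v)) (hl : IsGeneric τ γ l) (η : ℂ)
    {a b c : Fin N} (hab : a ≠ b) (hbc : b ≠ c) (hac : a ≠ c) :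
    (shiftedR12 N τ γ η u l * shiftedR13 N τ γ (-η) (u + v) l * shiftedR23 N τ γ η v l)
        (basis3 a b c) =
      (shiftedR23 N τ γ (-η) v l * shiftedR13 N τ γ η (u + v) l * shiftedR12 N τ γ (-η) u l)
        (basis3 a b c) := by
  have hF := isFay_theta1 hτ
  have r12 {i j k : Fin N} (t : ℂ) (hij : i ≠ j) (hik : i ≠ k) (hjk : j ≠ k) :=
    shiftedR12_of_ne (c := t) (l := l) (k := k) hτ hγ hu.1 hij (d := l i - l j) (by simp [hik, hjk])
  have r13 {i j k : Fin N} (t : ℂ) (hij : i ≠ j) (hik : i ≠ k) (hjk : j ≠ k) :=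
    shiftedR13_of_ne (c := t) (l := l) (j := j) hτ hγ hw.1 hik (d := l i - l k)
      (by simp [hij, hjk.symm])
  have r23 {i j k : Fin N} (t : ℂ) (hij : i ≠ j) (hik : i ≠ k) (hjk : j ≠ k) :=
    shiftedR23_of_ne (c := t) (l := l) (i := i) hτ hγ hv.1 hjk (d := l j - l k)
      (by simp [hij.symm, hik.symm])
  have hx := (hl a b hab).1
  have hy := (hl b c hbc).1
  have hxy := (hl a c hac).1
  rw [← sub_add_sub_cancel _ (l b)] at hxy
  have e₁ := hF.exch_diag_exch hx hy hxy hu.2 hv.2 hw.2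
  have e₂ := hF.exch_diag_exch' hx hy hxy hu.2 hv.2 hw.2
  have e₃ := hF.exch_exch_exch hx hy hxy hu.2 hv.2 hw.2
  simp only [neg_sub, sub_add_sub_cancel] at e₁ e₂ e₃
  simp only [Module.End.mul_apply, map_add, map_smul, r12 _ hab hac hbc,
    r12 _ hbc.symm hac.symm hab.symm,
    r12 _ hac hab hbc.symm, r12 _ hbc hab.symm hac.symm, r13 _ hab hac hbc, r13 _ hac hab hbc.symm,
    r13 _ hab.symm hbc hac, r23 _ hab hac hbc, r23 _ hbc.symm hac.symm hab.symm,
    r23 _ hab.symm hbc hac, r23 _ hac.symm hbc.symm hab, neg_sub]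
  linear_combination (norm := module) e₁ • basis3 c a b + e₂ • basis3 b c a + e₃ • basis3 c b a +
    (exchCoef (theta1 · τ) γ v (l c - l b) *
      diagCoef_mul_comm (theta1 · τ) γ u (u + v) (l a - l c) (l a - l b)) • basis3 a c b +
    (exchCoef (theta1 · τ) γ u (l b - l a) *
      diagCoef_mul_comm (theta1 · τ) γ v (u + v) (l b - l c) (l a - l c)) • basis3 b a c

/-- On basis vectors with one index repeated, the shift in the direction of the repeated index
changes `λ_a - λ_b` by `±γ / 2`. -/
theorem yangBaxter_of_eq_of_ne (hτ : 0 < τ.im) (hγ : theta1 γ τ ≠ 0) (hu : IsRegular τ γ u)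
    (hv : IsRegular τ γ v) (hw : IsRegular τ γ (u + v)) (hl : IsGeneric τ γ l)
    {a b : Fin N} (hab : a ≠ b) :
    ∀ t ∈ ({basis3 a a b, basis3 a b a, basis3 b a a} :
        Set ((Fin N → ℂ) ⊗[ℂ] ((Fin N → ℂ) ⊗[ℂ] (Fin N → ℂ)))),
      (shiftedR12 N τ γ (γ / 2) u l * shiftedR13 N τ γ (-(γ / 2)) (u + v) l *
          shiftedR23 N τ γ (γ / 2) v l) t =
        (shiftedR23 N τ γ (-(γ / 2)) v l * shiftedR13 N τ γ (γ / 2) (u + v) l *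
          shiftedR12 N τ γ (-(γ / 2)) u l) t := by
  have hF := isFay_theta1 hτ
  have d₁ (t : ℂ) : (l + t • (Pi.single a 1 : Diag N)) a - (l + t • (Pi.single a 1 : Diag N)) b =
      l a - l b + t := by
    simp [hab.symm]
    ring
  have d₂ (t : ℂ) : (l + t • (Pi.single a 1 : Diag N)) b - (l + t • (Pi.single a 1 : Diag N)) a =
      -(l a - l b + t) := by
    rw [← d₁, neg_sub]
  have r12 (t : ℂ) := shiftedR12_of_ne (k := a) hτ hγ hu.1 hab (d₁ t)
  have r12' (t : ℂ) := shiftedR12_of_ne (k := a) hτ hγ hu.1 hab.symm (d₂ t)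
  have r13 (t : ℂ) := shiftedR13_of_ne (j := a) hτ hγ hw.1 hab (d₁ t)
  have r13' (t : ℂ) := shiftedR13_of_ne (j := a) hτ hγ hw.1 hab.symm (d₂ t)
  have r23 (t : ℂ) := shiftedR23_of_ne (i := a) hτ hγ hv.1 hab (d₁ t)
  have r23' (t : ℂ) := shiftedR23_of_ne (i := a) hτ hγ hv.1 hab.symm (d₂ t)
  have hp := (hl a b hab).2
  have hm : theta1 (l a - l b + -(γ / 2)) τ ≠ 0 := by
    have h := (hl b a hab.symm).2
    rwa [← neg_ne_zero, ← theta1_neg, neg_add, neg_sub] at h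
  -- The two shifted differences are `p` and `p - γ`.
  obtain ⟨p, hlp⟩ : ∃ p, l a - l b + γ / 2 = p := ⟨_, rfl⟩
  have hlm : l a - l b + -(γ / 2) = p - γ := by
    rw [← hlp]
    ring
  rw [hlp] at hp
  rw [hlm] at hm
  have e₁ : γ - p = -(p - γ) := by ring
  have e₂ : γ + (p - γ) = p := by ring
  have e₃ : γ + -p = -(p - γ) := by ring
  have e₄ : γ - -(p - γ) = p := by ring
  have hm' : theta1 (-(p - γ)) τ ≠ 0 := by rwa [theta1_neg, neg_ne_zero]
  have hp' : theta1 (-p) τ ≠ 0 := by rwa [theta1_neg, neg_ne_zero]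
  have hw' : theta1 (γ - (v + u)) τ ≠ 0 := by rw [add_comm]; exact hw.2
  rintro _ (rfl | rfl | rfl)
  · have h₁ := hF.shifted_exch_left hp (by rwa [e₁]) hu.2 hv.2 hw.2
    have h₂ := hF.shifted_exch_right hp (by rwa [e₁]) hu.2 hv.2 hw.2
    rw [e₁] at h₁ h₂
    simp only [map_add, map_smul, r12, r12', r13, r23, shiftedR12_self, shiftedR13_self,
      shiftedR23_self, hlp, hlm, neg_neg,
      Module.End.mul_apply]
    linear_combination (norm := module) h₁ • basis3 a b a + h₂ • basis3 b a a +
      (diagCoef_mul_comm (theta1 · τ) γ v (u + v) p (p - γ)) • basis3 a a b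
  · have h₁ := hF.shifted_exch_middle hm (by rwa [e₂]) hu.2 hv.2 hw.2
    have h₂ := hF.shifted_diag hp (by rwa [e₁]) hu.2 hv.2 hw.2
    have h₃ := hF.shifted_exch_middle hp' (by rwa [e₃]) hv.2 hu.2 hw'
    rw [e₂] at h₁
    rw [e₁] at h₂
    rw [e₃, add_comm v u, neg_neg] at h₃
    simp only [map_add, map_smul, r12, r12', r13, r13', r23, r23', shiftedR12_self,
      shiftedR13_self, shiftedR23_self, hlp, hlm, neg_neg,
      Module.End.mul_apply]
    linear_combination (norm := module) h₁ • basis3 a a b + h₂ • basis3 a b a - h₃ • basis3 b a a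
  · have h₁ := hF.shifted_exch_left hm' (by rwa [e₄]) hv.2 hu.2 hw'
    have h₂ := hF.shifted_exch_right hm' (by rwa [e₄]) hv.2 hu.2 hw'
    rw [e₄, add_comm v u, neg_neg] at h₁ h₂
    simp only [map_add, map_smul, r12', r13', r23, r23', shiftedR12_self, shiftedR13_self,
      shiftedR23_self, hlp, hlm, neg_neg,
      Module.End.mul_apply]
    linear_combination (norm := module) -h₁ • basis3 a b a - h₂ • basis3 a a b +
      (diagCoef_mul_comm (theta1 · τ) γ u (u + v) (-p) (-(p - γ))) • basis3 b a a

theorem yangBaxter (hτ : 0 < τ.im) (hγ : theta1 γ τ ≠ 0) (hu : IsRegular τ γ u)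
    (hv : IsRegular τ γ v) (hw : IsRegular τ γ (u + v)) (hl : IsGeneric τ γ l) :
    shiftedR12 N τ γ (γ / 2) u l * shiftedR13 N τ γ (-(γ / 2)) (u + v) l *
        shiftedR23 N τ γ (γ / 2) v l =
      shiftedR23 N τ γ (-(γ / 2)) v l * shiftedR13 N τ γ (γ / 2) (u + v) l *
        shiftedR12 N τ γ (-(γ / 2)) u l := by
  refine ext_basis3 fun i j k => ?_
  by_cases hij : i = j
  · by_cases hik : i = k
    · subst hij hik
      simp only [Module.End.mul_apply, shiftedR12_self, shiftedR13_self, shiftedR23_self]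
    · exact yangBaxter_of_eq_of_ne hτ hγ hu hv hw hl hik _ (by simp [hij])
  · by_cases hik : i = k
    · exact yangBaxter_of_eq_of_ne hτ hγ hu hv hw hl hij _ (by simp [hik])
    · by_cases hjk : j = k
      · exact yangBaxter_of_eq_of_ne hτ hγ hu hv hw hl (Ne.symm hij) _ (by simp [hjk])
      · exact yangBaxter_of_pairwise_ne hτ hγ hu hv hw hl (γ / 2) hij hjk hik

theorem leg21_basis2 {T : Module.End ℂ ((Fin N → ℂ) ⊗[ℂ] (Fin N → ℂ))} {i j i' j' : Fin N}
    {s t : ℂ} (h : T (basis2 j i) = s • basis2 j i + t • basis2 j' i') :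
    leg21 T (basis2 i j) = s • basis2 i j + t • basis2 i' j' := by
  simp only [basis2] at h
  simp [leg21, basis2, h]

theorem unitarity (hτ : 0 < τ.im) (hγ : theta1 γ τ ≠ 0) (hz : IsRegular τ γ z)
    (hz' : IsRegular τ γ (-z)) (hl : IsGeneric τ γ l) :
    ellipticR N τ γ z l * leg21 (ellipticR N τ γ (-z) l) = 1 := by
  have hF := isFay_theta1 hτ
  have hγz := hz'.2
  rw [sub_neg_eq_add] at hγz
  refine ext_basis2 fun a b => ?_
  by_cases hab : a = b
  · subst hab
    rw [Module.End.mul_apply, leg21_basis2 (ellipticR_basis2_self' ..), one_smul, zero_smul,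
      add_zero, ellipticR_basis2_self, Module.End.one_apply]
  · have h₁ := hF.unitarity_exch (hl a b hab).1 hz.2 hγz
    have h₂ := hF.unitarity_diag (hl a b hab).1 hz.2 hγz
    have h := ellipticR_basis2_of_ne hτ hγ hz.1 l hab
    have h' := ellipticR_basis2_of_ne hτ hγ hz.1 l (Ne.symm hab)
    have h'' := leg21_basis2 (ellipticR_basis2_of_ne hτ hγ hz'.1 l (Ne.symm hab))
    simp only [neg_sub] at h₁ h₂ h h' h''
    rw [Module.End.mul_apply, h'', map_add, map_smul, map_smul, h, h', Module.End.one_apply]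
    linear_combination (norm := module) h₁ • basis2 b a + h₂ • basis2 a b

theorem diagAction_single (X : Diag N) (k : Fin N) :
    diagAction N X (Pi.single k 1) = X k • (Pi.single k 1 : Fin N → ℂ) := by
  ext m
  rw [diagAction_apply]
  by_cases h : m = k <;> simp [h]

theorem weightZero (τ γ z : ℂ) (l X : Diag N) :
    (TensorProduct.map (diagAction N X) LinearMap.id +
        TensorProduct.map LinearMap.id (diagAction N X)) * ellipticR N τ γ z l =
      ellipticR N τ γ z l * (TensorProduct.map (diagAction N X) LinearMap.id +
        TensorProduct.map LinearMap.id (diagAction N X)) := by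
  have h (i j : Fin N) : (TensorProduct.map (diagAction N X) LinearMap.id +
      TensorProduct.map LinearMap.id (diagAction N X) : Module.End ℂ ((Fin N → ℂ) ⊗[ℂ] (Fin N → ℂ)))
        (basis2 i j) = (X i + X j) • basis2 i j := by
    simp [basis2, diagAction_single, add_smul, ← TensorProduct.smul_tmul']
  refine ext_basis2 fun a b => ?_
  rw [Module.End.mul_apply, Module.End.mul_apply, h, map_smul, ellipticR_basis2]
  split_ifs <;> simp only [map_add, map_smul, map_zero, h] <;> module

end YangBaxter

/-! ### Generic points -/

section Density

variable {E : Type*} [NormedAddCommGroup E] [NormedSpace ℂ E] {τ γ : ℂ}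

theorem isOpen_theta1_comp_ne_zero {E : Type*} [TopologicalSpace E] {τ : ℂ} (hτ : 0 < τ.im)
    {f : E → ℂ} (hf : Continuous f) :
    IsOpen {p | theta1 (f p) τ ≠ 0} :=
  isOpen_ne_fun ((differentiable_theta1 hτ).continuous.comp hf) continuous_const

/-- A function that restricts to a translation on every complex line in some direction `e` pulls
back the dense set `{θ₁ ≠ 0}` to a dense set. -/
theorem dense_theta1_comp_ne_zero (hτ : 0 < τ.im) (hγ : theta1 γ τ ≠ 0) {f : E → ℂ} (e : E)
    (he : ∀ p (t : ℂ), f (p + t • e) = f p + t) : Dense {p | theta1 (f p) τ ≠ 0} := by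
  intro p
  have hp : p = p + (f p - f p) • e := by simp
  rw [hp]
  refine map_mem_closure (f := fun s : ℂ => p + (s - f p) • e) (by fun_prop)
    (dense_theta1_ne_zero hτ hγ (f p)) fun s hs => ?_
  rw [Set.mem_ofPred_eq, he, add_sub_cancel]
  exact hs

theorem isOpen_dense_isRegular (hτ : 0 < τ.im) (hγ : theta1 γ τ ≠ 0) {f : E → ℂ}
    (hf : Continuous f) (e : E) (he : ∀ p (t : ℂ), f (p + t • e) = f p + t) :
    IsOpen {p | IsRegular τ γ (f p)} ∧ Dense {p | IsRegular τ γ (f p)} := by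
  have h₁ := isOpen_theta1_comp_ne_zero hτ hf
  have h₂ := isOpen_theta1_comp_ne_zero (f := fun p => γ - f p) hτ (by fun_prop)
  refine ⟨h₁.inter h₂, (dense_theta1_comp_ne_zero hτ hγ e he).inter_of_isOpen_left
    (dense_theta1_comp_ne_zero hτ hγ (-e) fun p t => ?_) h₁⟩
  rw [smul_neg, ← neg_smul, he]
  ring

theorem isOpen_dense_isGeneric [CompleteSpace E] (hτ : 0 < τ.im) (hγ : theta1 γ τ ≠ 0) {N : ℕ}
    {f : E → Diag N} (hf : Continuous f) (e : Fin N → E)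
    (he : ∀ p (t : ℂ) a, f (p + t • e a) = f p + t • Pi.single a 1) :
    IsOpen {p | IsGeneric τ γ (f p)} ∧ Dense {p | IsGeneric τ γ (f p)} := by
  have hU : {p | IsGeneric τ γ (f p)} = ⋂ q : {q : Fin N × Fin N // q.1 ≠ q.2},
      {p | theta1 (f p q.1.1 - f p q.1.2) τ ≠ 0} ∩
        {p | theta1 (f p q.1.1 - f p q.1.2 + γ / 2) τ ≠ 0} := by
    ext p
    simp [IsGeneric]
  have ho (c : ℂ) (a b : Fin N) : IsOpen {p | theta1 (f p a - f p b + c) τ ≠ 0} :=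
    isOpen_theta1_comp_ne_zero hτ (by fun_prop)
  have hd (c : ℂ) (a b : Fin N) (hab : a ≠ b) : Dense {p | theta1 (f p a - f p b + c) τ ≠ 0} := by
    refine dense_theta1_comp_ne_zero hτ hγ (e a) fun p t => ?_
    simp [he, hab.symm]
    ring
  have ho' (a b : Fin N) := ho 0 a b
  have hd' (a b : Fin N) (hab : a ≠ b) := hd 0 a b hab
  simp only [add_zero] at ho' hd'
  rw [hU]
  exact ⟨isOpen_iInter_of_finite fun q => (ho' _ _).inter (ho _ _ _),
    dense_iInter_of_isOpen (fun q => (ho' _ _).inter (ho _ _ _)) fun q =>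
      (hd' _ _ q.2).inter_of_isOpen_left (hd _ _ _ q.2) (ho' _ _)⟩

end Density

/-! ### Meromorphy -/

section Meromorphy

variable {E : Type*} [NormedAddCommGroup E] [NormedSpace ℂ E]

/-- `f` is a quotient of two entire functions, the denominator being nonzero on a dense set.
As in `IsMeromorphic`, the values of `f` at the zeros of the denominator are irrelevant. -/
def IsEntireQuotient (f : E → ℂ) : Prop :=
  ∃ g h : E → ℂ, (∀ x, AnalyticAt ℂ g x) ∧ (∀ x, AnalyticAt ℂ h x) ∧
    Dense {x | h x ≠ 0} ∧ ∀ x, h x ≠ 0 → f x = g x / h x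

namespace IsEntireQuotient

theorem isMeromorphic {f : E → ℂ} (hf : IsEntireQuotient f) : IsMeromorphic f := by
  obtain ⟨g, h, hg, hh, hd, hfgh⟩ := hf
  exact fun x => ⟨g, h, hg x, hh x, mem_closure_iff_frequently.1 (hd x), .of_forall hfgh⟩

theorem const (c : ℂ) : IsEntireQuotient fun _ : E => c :=
  ⟨fun _ => c, fun _ => 1, fun _ => analyticAt_const, fun _ => analyticAt_const, by simp, by simp⟩

theorem dense_mul_ne_zero {g h : E → ℂ} (hg : ∀ x, AnalyticAt ℂ g x)
    (hgd : Dense {x | g x ≠ 0}) (hhd : Dense {x | h x ≠ 0}) : Dense {x | g x * h x ≠ 0} := by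
  have ho : IsOpen {x | g x ≠ 0} :=
    isOpen_ne_fun (continuous_iff_continuousAt.2 fun x => (hg x).continuousAt) continuous_const
  simp only [mul_ne_zero_iff]
  exact hgd.inter_of_isOpen_left hhd ho

theorem add {f₁ f₂ : E → ℂ} (h₁ : IsEntireQuotient f₁) (h₂ : IsEntireQuotient f₂) :
    IsEntireQuotient fun x => f₁ x + f₂ x := by
  obtain ⟨g₁, k₁, hg₁, hk₁, hd₁, e₁⟩ := h₁
  obtain ⟨g₂, k₂, hg₂, hk₂, hd₂, e₂⟩ := h₂
  refine ⟨fun x => g₁ x * k₂ x + k₁ x * g₂ x, fun x => k₁ x * k₂ x,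
    fun x => ((hg₁ x).mul (hk₂ x)).add ((hk₁ x).mul (hg₂ x)), fun x => (hk₁ x).mul (hk₂ x),
    dense_mul_ne_zero hk₁ hd₁ hd₂, fun x hx => ?_⟩
  rw [mul_ne_zero_iff] at hx
  beta_reduce
  rw [e₁ x hx.1, e₂ x hx.2, div_add_div _ _ hx.1 hx.2]

theorem mul_const {f : E → ℂ} (hf : IsEntireQuotient f) (c : ℂ) :
    IsEntireQuotient fun x => f x * c := by
  obtain ⟨g, k, hg, hk, hd, e⟩ := hf
  refine ⟨fun x => g x * c, k, fun x => (hg x).mul analyticAt_const, hk, hd, fun x hx => ?_⟩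
  beta_reduce
  rw [e x hx, div_mul_eq_mul_div]

theorem sum {ι : Type*} (s : Finset ι) {f : ι → E → ℂ} (hf : ∀ i ∈ s, IsEntireQuotient (f i)) :
    IsEntireQuotient fun x => ∑ i ∈ s, f i x := by
  classical
  induction s using Finset.induction_on with
  | empty => simpa using const 0
  | insert i s hi ih =>
    simp only [Finset.sum_insert hi]
    exact (hf i (Finset.mem_insert_self i s)).add
      (ih fun j hj => hf j (Finset.mem_insert_of_mem hj))

end IsEntireQuotient

theorem analyticAt_theta1_comp {τ : ℂ} (hτ : 0 < τ.im) {f : E → ℂ} {x : E}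
    (hf : AnalyticAt ℂ f x) : AnalyticAt ℂ (fun p => theta1 (f p) τ) x :=
  ((differentiable_theta1 hτ).analyticAt (f x)).comp hf

variable {N : ℕ} {τ γ : ℂ}

theorem analyticAt_apply_snd (a : Fin N) (x : ℂ × Diag N) :
    AnalyticAt ℂ (fun p : ℂ × Diag N => p.2 a) x :=
  ((ContinuousLinearMap.proj (R := ℂ) (φ := fun _ : Fin N => ℂ) a).comp
    (ContinuousLinearMap.snd ℂ ℂ (Diag N))).analyticAt x

theorem dense_denominator (hτ : 0 < τ.im) (hγ : theta1 γ τ ≠ 0) {a b : Fin N} (hab : a ≠ b) :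
    Dense {p : ℂ × Diag N |
      theta1 (p.2 a - p.2 b) τ * (theta1 p.1 τ * theta1 (γ - p.1) τ) ≠ 0} := by
  refine IsEntireQuotient.dense_mul_ne_zero (fun x => analyticAt_theta1_comp hτ
    ((analyticAt_apply_snd a x).sub (analyticAt_apply_snd b x))) ?_ ?_
  · refine dense_theta1_comp_ne_zero hτ hγ (0, Pi.single a 1) fun p t => ?_
    simp [hab.symm]
    ring
  · simpa only [IsRegular, ← mul_ne_zero_iff] using
      (isOpen_dense_isRegular (f := fun p : ℂ × Diag N => p.1) hτ hγ continuous_fst (1, 0)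
        (by simp)).2

theorem isEntireQuotient_diag (hτ : 0 < τ.im) (hγ : theta1 γ τ ≠ 0) {a b : Fin N} (hab : a ≠ b) :
    IsEntireQuotient fun p : ℂ × Diag N => sigma τ γ (p.2 a - p.2 b) / sigma τ γ p.1 := by
  have hx (x : ℂ × Diag N) := (analyticAt_apply_snd a x).sub (analyticAt_apply_snd b x)
  have hz (x : ℂ × Diag N) : AnalyticAt ℂ (fun p : ℂ × Diag N => p.1) x := analyticAt_fst
  -- The extra factor `θ₁(z)` allows the same denominator as for the exchange coefficients.
  refine ⟨fun p => theta1 (γ - (p.2 a - p.2 b)) τ * theta1 p.1 τ * theta1 p.1 τ, _,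
    fun x => ?_, fun x => ?_, dense_denominator hτ hγ hab, fun p hp => ?_⟩
  · exact ((analyticAt_theta1_comp hτ (analyticAt_const.sub (hx x))).mul
      (analyticAt_theta1_comp hτ (hz x))).mul (analyticAt_theta1_comp hτ (hz x))
  · exact (analyticAt_theta1_comp hτ (hx x)).mul ((analyticAt_theta1_comp hτ (hz x)).mul
      (analyticAt_theta1_comp hτ (analyticAt_const.sub (hz x))))
  · simp only [mul_ne_zero_iff] at hp
    obtain ⟨h₁, h₂, h₃⟩ := hp
    beta_reduce
    rw [sigma_div_sigma_diag hτ hγ, diagCoef]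
    field_simp

theorem isEntireQuotient_exch (hτ : 0 < τ.im) (hγ : theta1 γ τ ≠ 0) {a b : Fin N} (hab : a ≠ b) :
    IsEntireQuotient fun p : ℂ × Diag N => sigma τ (p.2 a - p.2 b) p.1 / sigma τ γ p.1 := by
  have hx (x : ℂ × Diag N) := (analyticAt_apply_snd a x).sub (analyticAt_apply_snd b x)
  have hz (x : ℂ × Diag N) : AnalyticAt ℂ (fun p : ℂ × Diag N => p.1) x := analyticAt_fst
  refine ⟨fun p => theta1 (p.2 a - p.2 b - p.1) τ * theta1 γ τ * theta1 p.1 τ, _,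
    fun x => ?_, fun x => ?_, dense_denominator hτ hγ hab, fun p hp => ?_⟩
  · exact ((analyticAt_theta1_comp hτ ((hx x).sub (hz x))).mul analyticAt_const).mul
      (analyticAt_theta1_comp hτ (hz x))
  · exact (analyticAt_theta1_comp hτ (hx x)).mul ((analyticAt_theta1_comp hτ (hz x)).mul
      (analyticAt_theta1_comp hτ (analyticAt_const.sub (hz x))))
  · simp only [mul_ne_zero_iff] at hp
    obtain ⟨h₁, h₂, h₃⟩ := hp
    beta_reduce
    rw [sigma_div_sigma_exch hτ hγ h₂, exchCoef]
    field_simp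

theorem isMeromorphicVec_ellipticR (hτ : 0 < τ.im) (hγ : theta1 γ τ ≠ 0) :
    IsMeromorphicVec fun p : ℂ × Diag N => ellipticR N τ γ p.1 p.2 := by
  intro φ
  refine IsEntireQuotient.isMeromorphic ?_
  simp only [ellipticR, map_add, map_sum, map_smul, smul_eq_mul]
  refine ((IsEntireQuotient.const _).add ?_).add ?_
  · refine .sum _ fun i _ => .sum _ fun j hj => ?_
    exact (isEntireQuotient_diag hτ hγ (Finset.mem_filter.1 hj).2).mul_const _
  · refine .sum _ fun i _ => .sum _ fun j hj => ?_
    exact (isEntireQuotient_exch hτ hγ (Finset.mem_filter.1 hj).2).mul_const _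

end Meromorphy

/-! ### The identities of meromorphic functions -/

section RMatrix

variable {N : ℕ} {τ γ : ℂ}

theorem mybe_ellipticR (hτ : 0 < τ.im) (hγ : theta1 γ τ ≠ 0) :
    MYBE (traceForm N) (diagAction N) (γ / 2) (ellipticR N τ γ) := by
  have h₁ := isOpen_dense_isRegular (f := fun p : ℂ × ℂ × ℂ × Diag N => p.1 - p.2.1) hτ hγ
    (by fun_prop) (1, 0) (by intro p t; simp; ring)
  have h₂ := isOpen_dense_isRegular (f := fun p : ℂ × ℂ × ℂ × Diag N => p.2.1 - p.2.2.1) hτ hγ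
    (by fun_prop) (0, 1, 0) (by intro p t; simp; ring)
  have h₃ := isOpen_dense_isRegular (f := fun p : ℂ × ℂ × ℂ × Diag N => p.1 - p.2.2.1) hτ hγ
    (by fun_prop) (1, 0) (by intro p t; simp; ring)
  have h₄ := isOpen_dense_isGeneric (f := fun p : ℂ × ℂ × ℂ × Diag N => p.2.2.2) hτ hγ
    (by fun_prop) (fun a => (0, 0, 0, Pi.single a 1)) (by intro p t a; simp)
  refine ⟨_, ((h₁.1.inter h₂.1).inter h₃.1).inter h₄.1,
    (((h₁.2.inter_of_isOpen_left h₂.2 h₁.1).inter_of_isOpen_left h₃.2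
      (h₁.1.inter h₂.1)).inter_of_isOpen_left h₄.2 ((h₁.1.inter h₂.1).inter h₃.1)), ?_⟩
  rintro ⟨z₁, z₂, z₃, l⟩ ⟨⟨⟨hu, hv⟩, hw⟩, hl⟩
  simp only [Set.mem_ofPred_eq] at hu hv hw hl
  rw [← sub_add_sub_cancel z₁ z₂ z₃] at hw
  have h := yangBaxter hτ hγ hu hv hw hl
  rw [sub_add_sub_cancel] at h
  exact h

theorem unitary_ellipticR (hτ : 0 < τ.im) (hγ : theta1 γ τ ≠ 0) :
    Unitary (ellipticR N τ γ) := by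
  have h₁ := isOpen_dense_isRegular (f := fun p : ℂ × Diag N => p.1) hτ hγ
    (by fun_prop) (1, 0) (by intro p t; simp)
  have h₂ := isOpen_dense_isRegular (f := fun p : ℂ × Diag N => -p.1) hτ hγ
    (by fun_prop) (-1, 0) (by intro p t; simp; ring)
  have h₃ := isOpen_dense_isGeneric (f := fun p : ℂ × Diag N => p.2) hτ hγ
    (by fun_prop) (fun a => (0, Pi.single a 1)) (by intro p t a; simp)
  refine ⟨_, (h₁.1.inter h₂.1).inter h₃.1,
    ((h₁.2.inter_of_isOpen_left h₂.2 h₁.1).inter_of_isOpen_left h₃.2 (h₁.1.inter h₂.1)), ?_⟩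
  rintro ⟨z, l⟩ ⟨⟨hz, hz'⟩, hl⟩
  exact unitarity hτ hγ hz hz' hl

end RMatrix

end EllipticRMatrix

theorem mainTheorem2 (N : ℕ) (τ γ : ℂ) (hτ : 0 < τ.im)
    (hγ : EllipticRMatrix.theta1 γ τ ≠ 0) :
    EllipticRMatrix.IsGeneralizedRMatrix (EllipticRMatrix.traceForm N)
      (EllipticRMatrix.diagAction N) (γ / 2) (EllipticRMatrix.ellipticR N τ γ) where
  diagonalizable := EllipticRMatrix.isDiagonalizable_diagAction N
  meromorphic := EllipticRMatrix.isMeromorphicVec_ellipticR hτ hγ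
  mybe := EllipticRMatrix.mybe_ellipticR hτ hγ
  unitary := EllipticRMatrix.unitary_ellipticR hτ hγ
  weightZero := fun X => ⟨Set.univ, isOpen_univ, dense_univ, fun p _ =>
    EllipticRMatrix.weightZero τ γ p.1 p.2 X⟩
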